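/- Let $p$ be a prime and let $(H,\omega)$ be a saturated $p$-valued group: $H$ is a topological group and $\omega : H\to\mathbb{R}\cup\{\infty\}$ satisfies $\omega(g)=\infty \Leftrightarrow g=1$, $\omega(g)>\frac{1}{p-1}$, $\omega(g^{-1}h)\ge\min\{\omega(g),\omega(h)\}$, $\omega(ghg^{-1}h^{-1})\ge\omega(g)+\omega(h)$ and $\omega(g^p)=\omega(g)+1$, the sets $\{g:\omega(g)\ge\nu\}$ ($\nu\in\mathbb{R}$) form a basis of neighbourhoods of $1$, and every $g$ with $\omega(g)>\frac{p}{p-1}$ is a $p$-th power. An ordered basis of $(H,\omega)$ is a tuple $(h_1,\dots,h_d)$ in $H$ such that $(x_1,\dots,x_d)\mapsto h_1^{x_1}\cdots h_d^{x_d}$ is a homeomorphism $\mathbb{Z}_p^d\to H$ and $\omega(h_1^{x_1}\cdots h_d^{x_d})=\min_i\{v(x_i)+\omega(h_i)\}$. Let $(h_1,\dots,h_d)$ and $(h_1',\dots,h_d')$ be two ordered bases of $(H,\omega)$. (1) There is exactly one rigid analytic group $\mathbb{H}$ over $\mathbb{Q}_p$ whose underlying rigid analytic space is the closed ball $\mathrm{Sp}\,\mathbb{Q}_p\langle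 Z_1,\dots,Z_d\rangle$ and for which $\varphi\mapsto h_1^{\varphi(Z_1)}\cdots h_d^{\varphi(Z_d)}$ is an isomorphism of abstract groups $\mathbb{H}(\mathbb{Q}_p)=\mathrm{Hom}_{\mathbb{Q}_p\text{-alg}}(\mathbb{Q}_p\langle Z_1,\dots,Z_d\rangle,\mathbb{Q}_p)\to H$; likewise there is exactly one such group $\mathbb{H}'$ for $(h_1',\dots,h_d')$. (2) There is a unique isomorphism of rigid analytic groups $\mathbb{H}\to\mathbb{H}'$ whose induced map $\mathbb{H}(\mathbb{Q}_p)\to\mathbb{H}'(\mathbb{Q}_p)$ is compatible with the above identifications of both groups with $H$. (3) Let $K/\mathbb{Q}_p$ be a finite extension with the absolute value extending that of $\mathbb{Q}_p$. Let $\mathcal{C}^{\mathrm{rig}}(H,K)$ be the $K$-algebra of functions $f:H\to K$ of the form $f(h_1^{x_1}\cdots h_d^{x_d})=\sum_I c_I x_1^{i_1}\cdots x_d^{i_d}$ with $c_I\in K$, $c_I\to 0$ as $|I|\to\infty$. These functions are continuous, the coefficients $c_I$ are determined by $f$, so that with the Gauss norm $\|f\|=\sup_I|c_I|$ the algebra $\mathcal{C}^{\mathrm{rig}}(H,K)$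 is isometrically isomorphic to the Banach algebra $K\langle Z_1,\dots,Z_d\rangle$; and both the algebra $\mathcal{C}^{\mathrm{rig}}(H,K)$ and its Gauss norm are the same for the basis $(h_1',\dots,h_d')$. -/

import Mathlib

open Filter Topology

noncomputable section

/-! ## Tate algebras -/

section Tate

variable (K : Type*) [NormedField K] [IsUltrametricDist K] (σ : Type*)

/-- Power series over `K` in the variables `Z_i`, `i : σ`, whose coefficients form a null
sequence (tend to `0` along the cofinite filter on multi-indices). -/
def tateSubalgebra : Subalgebra K (MvPowerSeries σ K) where
  carrier := {f | Tendsto (fun I => MvPowerSeries.coeff I f) cofinite (𝓝 0)}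
  mul_mem' {f g} hf hg := by
    have key : ∀ f : MvPowerSeries σ K, MvPowerSeries.IsRestricted (fun _ => 1) f ↔
        Tendsto (fun I => MvPowerSeries.coeff I f) cofinite (𝓝 0) := fun f => by
      simp [MvPowerSeries.IsRestricted, tendsto_zero_iff_norm_tendsto_zero, Finsupp.prod]
    exact (key _).1 (MvPowerSeries.isRestricted.mul _ ((key f).2 hf) ((key g).2 hg))
  add_mem' {f g} hf hg := by
    simpa using Tendsto.add hf hg
  algebraMap_mem' r := by
    have key : ∀ f : MvPowerSeries σ K, MvPowerSeries.IsRestricted (fun _ => 1) f ↔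
        Tendsto (fun I => MvPowerSeries.coeff I f) cofinite (𝓝 0) := fun f => by
      simp [MvPowerSeries.IsRestricted, tendsto_zero_iff_norm_tendsto_zero, Finsupp.prod]
    exact (key _).1 (MvPowerSeries.isRestricted_C _ r)

/-- The Tate algebra `K⟨Z_i : i ∈ σ⟩`. -/
def TateAlgebra : Type _ := tateSubalgebra K σ

namespace TateAlgebra

variable {K σ}

instance : CommRing (TateAlgebra K σ) := inferInstanceAs (CommRing (tateSubalgebra K σ))
instance : Algebra K (TateAlgebra K σ) := inferInstanceAs (Algebra K (tateSubalgebra K σ))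

/-- The coefficient of a Tate series at a multi-index. -/
def coeff (I : σ →₀ ℕ) (f : TateAlgebra K σ) : K := MvPowerSeries.coeff I f.1

theorem ext {f g : TateAlgebra K σ} (h : ∀ I, coeff I f = coeff I g) : f = g :=
  Subtype.ext (MvPowerSeries.ext h)

theorem tendsto_coeff (f : TateAlgebra K σ) : Tendsto (fun I => coeff I f) cofinite (𝓝 0) := f.2

theorem coeff_zero (I : σ →₀ ℕ) : coeff I (0 : TateAlgebra K σ) = 0 := rfl

theorem coeff_add (I : σ →₀ ℕ) (f g : TateAlgebra K σ) :
    coeff I (f + g) = coeff I f + coeff I g := rfl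

theorem coeff_neg (I : σ →₀ ℕ) (f : TateAlgebra K σ) : coeff I (-f) = -coeff I f := rfl

theorem coeff_sub (I : σ →₀ ℕ) (f g : TateAlgebra K σ) :
    coeff I (f - g) = coeff I f - coeff I g := rfl

theorem coeff_smul (I : σ →₀ ℕ) (r : K) (f : TateAlgebra K σ) :
    coeff I (r • f) = r * coeff I f := rfl

theorem coeff_mul [DecidableEq σ] (I : σ →₀ ℕ) (f g : TateAlgebra K σ) :
    coeff I (f * g) = ∑ q ∈ Finset.HasAntidiagonal.antidiagonal I, coeff q.1 f * coeff q.2 g :=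
  MvPowerSeries.coeff_mul I f.1 g.1

theorem coeff_algebraMap [DecidableEq σ] (I : σ →₀ ℕ) (r : K) :
    coeff I (algebraMap K (TateAlgebra K σ) r) = if I = 0 then r else 0 :=
  MvPowerSeries.coeff_C I r

theorem coeff_one [DecidableEq σ] (I : σ →₀ ℕ) :
    coeff I (1 : TateAlgebra K σ) = if I = 0 then 1 else 0 :=
  MvPowerSeries.coeff_one I

/-- The variable `Z_i`. -/
def X (i : σ) : TateAlgebra K σ :=
  ⟨MvPowerSeries.X i, by
    classical
    refine tendsto_nhds_of_eventually_eq ((Set.finite_singleton (Finsupp.single i 1)).subset ?_)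
    intro I hI
    by_contra h
    exact hI (by simpa [MvPowerSeries.coeff_X] using h)⟩

theorem coeff_X [DecidableEq σ] (I : σ →₀ ℕ) (i : σ) :
    coeff I (X i : TateAlgebra K σ) = if I = Finsupp.single i 1 then 1 else 0 :=
  MvPowerSeries.coeff_X I i

/-! ### The Gauss norm -/

/-- The Gauss norm `‖∑ c_I Z^I‖ = sup_I |c_I|`. -/
instance : Norm (TateAlgebra K σ) := ⟨fun f => ⨆ I, ‖coeff I f‖⟩

theorem norm_def (f : TateAlgebra K σ) : ‖f‖ = ⨆ I, ‖coeff I f‖ := rfl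

theorem bddAbove (f : TateAlgebra K σ) : BddAbove (Set.range fun I => ‖coeff I f‖) := by
  have h := (tendsto_zero_iff_norm_tendsto_zero.1 f.tendsto_coeff).eventually (gt_mem_nhds one_pos)
  have hfin : {I | ¬ ‖coeff I f‖ < 1}.Finite := h
  obtain ⟨C, hC⟩ := (hfin.image fun I => ‖coeff I f‖).bddAbove
  refine ⟨max C 1, ?_⟩
  rintro _ ⟨I, rfl⟩
  by_cases hI : ‖coeff I f‖ < 1
  · exact le_max_of_le_right hI.le
  · exact le_max_of_le_left (hC ⟨I, hI, rfl⟩)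

theorem norm_coeff_le (f : TateAlgebra K σ) (I : σ →₀ ℕ) : ‖coeff I f‖ ≤ ‖f‖ :=
  le_ciSup f.bddAbove I

theorem norm_le {f : TateAlgebra K σ} {C : ℝ} (h : ∀ I, ‖coeff I f‖ ≤ C) : ‖f‖ ≤ C :=
  ciSup_le h

theorem norm_nonneg' (f : TateAlgebra K σ) : 0 ≤ ‖f‖ :=
  (norm_nonneg _).trans (norm_coeff_le f 0)

theorem exists_norm_coeff_eq (f : TateAlgebra K σ) : ∃ I, ‖coeff I f‖ = ‖f‖ := by
  by_contra! hne
  have hlt : ∀ I, ‖coeff I f‖ < ‖f‖ := fun I => lt_of_le_of_ne (norm_coeff_le f I) (hne I)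
  have hpos : 0 < ‖f‖ := (norm_nonneg _).trans_lt (hlt 0)
  have h := (tendsto_zero_iff_norm_tendsto_zero.1 f.tendsto_coeff).eventually
    (gt_mem_nhds (half_pos hpos))
  have hfin : {I | ¬ ‖coeff I f‖ < ‖f‖ / 2}.Finite := h
  rcases hfin.toFinset.eq_empty_or_nonempty with he | hn
  · have : ‖f‖ ≤ ‖f‖ / 2 := norm_le fun I => by
      by_contra hI
      have : I ∈ hfin.toFinset := hfin.mem_toFinset.2 fun h' => hI (le_of_lt h')
      rw [he] at this
      exact absurd this (Finset.notMem_empty _)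
    linarith
  · obtain ⟨J, -, hJm⟩ := hfin.toFinset.exists_max_image (fun I => ‖coeff I f‖) hn
    have : ‖f‖ ≤ max ‖coeff J f‖ (‖f‖ / 2) := norm_le fun I => by
      by_cases hI : ‖coeff I f‖ < ‖f‖ / 2
      · exact le_max_of_le_right hI.le
      · exact le_max_of_le_left (hJm I (hfin.mem_toFinset.2 hI))
    rcases le_max_iff.1 this with h1 | h1
    · exact absurd h1 (not_le.2 (hlt J))
    · linarith

theorem norm_add_le_max' (f g : TateAlgebra K σ) : ‖f + g‖ ≤ max ‖f‖ ‖g‖ :=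
  norm_le fun I => (IsUltrametricDist.norm_add_le_max _ _).trans
    (max_le_max (norm_coeff_le f I) (norm_coeff_le g I))

theorem norm_mul_le' (f g : TateAlgebra K σ) : ‖f * g‖ ≤ ‖f‖ * ‖g‖ := by
  classical
  refine norm_le fun I => ?_
  rw [coeff_mul]
  refine IsUltrametricDist.norm_sum_le_of_forall_le_of_nonneg
    (mul_nonneg (norm_nonneg' f) (norm_nonneg' g)) fun q _ => ?_
  rw [norm_mul]
  exact mul_le_mul (norm_coeff_le f _) (norm_coeff_le g _) (norm_nonneg _) (norm_nonneg' f)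

/-- The Gauss norm as a ring norm. -/
def gaussRingNorm : RingNorm (TateAlgebra K σ) where
  toFun f := ‖f‖
  map_zero' := le_antisymm (norm_le fun I => by simp [coeff_zero]) (norm_nonneg' _)
  add_le' f g := (norm_add_le_max' f g).trans
    (max_le_add_of_nonneg (norm_nonneg' f) (norm_nonneg' g))
  neg' f := by simp [norm_def, coeff_neg]
  mul_le' := norm_mul_le'
  eq_zero_of_map_eq_zero' f hf := ext fun I => by
    have := (norm_coeff_le f I).trans_eq hf
    simpa [coeff_zero] using this

instance : NormedCommRing (TateAlgebra K σ) where
  __ := (inferInstance : CommRing (TateAlgebra K σ))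
  __ := (inferInstance : Norm (TateAlgebra K σ))
  __ := gaussRingNorm.toNormedRing

instance : NormedAlgebra K (TateAlgebra K σ) where
  norm_smul_le r f := norm_le fun I => by
    rw [coeff_smul, norm_mul]
    exact mul_le_mul_of_nonneg_left (norm_coeff_le f I) (norm_nonneg r)

instance : NormOneClass (TateAlgebra K σ) where
  norm_one := by
    classical
    refine le_antisymm (norm_le fun I => ?_) ?_
    · rw [coeff_one]; split_ifs <;> simp
    · simpa [coeff_one] using norm_coeff_le (1 : TateAlgebra K σ) 0

instance : Nontrivial (TateAlgebra K σ) := NormOneClass.nontrivial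

instance : IsUltrametricDist (TateAlgebra K σ) :=
  IsUltrametricDist.isUltrametricDist_of_isNonarchimedean_norm norm_add_le_max'

theorem norm_X_le (i : σ) : ‖(X i : TateAlgebra K σ)‖ ≤ 1 := by
  classical
  refine norm_le fun I => ?_
  rw [coeff_X]; split_ifs <;> simp

instance [CompleteSpace K] : CompleteSpace (TateAlgebra K σ) := by
  refine Metric.complete_of_cauchySeq_tendsto fun u hu => ?_
  have hc : ∀ I, ∃ c, Tendsto (fun n => coeff I (u n)) atTop (𝓝 c) := fun I => by
    refine cauchySeq_tendsto_of_complete (Metric.cauchySeq_iff.2 fun ε hε => ?_)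
    obtain ⟨N, hN⟩ := Metric.cauchySeq_iff.1 hu ε hε
    refine ⟨N, fun m hm n hn => ?_⟩
    rw [dist_eq_norm, ← coeff_sub]
    exact (norm_coeff_le _ I).trans_lt (by rw [← dist_eq_norm]; exact hN m hm n hn)
  choose c hc using hc
  have hunif : ∀ ε > 0, ∃ N, ∀ n ≥ N, ∀ I, ‖coeff I (u n) - c I‖ ≤ ε := fun ε hε => by
    obtain ⟨N, hN⟩ := Metric.cauchySeq_iff.1 hu ε hε
    refine ⟨N, fun n hn I => ?_⟩
    refine le_of_tendsto ((tendsto_const_nhds.sub (hc I)).norm) ?_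
    filter_upwards [eventually_ge_atTop N] with m hm
    rw [← coeff_sub]
    exact (norm_coeff_le _ I).trans (by rw [← dist_eq_norm]; exact (hN n hn m hm).le)
  have hcz : Tendsto c cofinite (𝓝 0) := by
    rw [Metric.tendsto_nhds]
    intro ε hε
    obtain ⟨N, hN⟩ := hunif (ε / 2) (half_pos hε)
    filter_upwards [(Metric.tendsto_nhds.1 (u N).tendsto_coeff) (ε / 2) (half_pos hε)] with I hI
    rw [dist_zero_right] at hI ⊢
    have h1 : c I = coeff I (u N) - (coeff I (u N) - c I) := by ring
    rw [h1]
    exact (norm_sub_le _ _).trans_lt (by linarith [hN N le_rfl I])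
  let F : TateAlgebra K σ := ⟨fun I => c I, hcz⟩
  refine ⟨F, Metric.tendsto_atTop.2 fun ε hε => ?_⟩
  obtain ⟨N, hN⟩ := hunif (ε / 2) (half_pos hε)
  refine ⟨N, fun n hn => ?_⟩
  rw [dist_eq_norm]
  exact (norm_le (f := u n - F) (hN n hn)).trans_lt (half_lt_self hε)

/-! ### Substitution: morphisms into a closed ball -/

theorem tsum_eval_algebraMap {B : Type*} [NormedCommRing B] [NormedAlgebra K B]
    (a : σ → B) (r : K) :
    (∑' I : σ →₀ ℕ, coeff I (algebraMap K (TateAlgebra K σ) r) • I.prod fun i n => a i ^ n) =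
      algebraMap K B r := by
  classical
  rw [tsum_eq_single 0 fun I hI => by rw [coeff_algebraMap, if_neg hI, zero_smul],
    coeff_algebraMap, if_pos rfl, Finsupp.prod_zero_index, Algebra.algebraMap_eq_smul_one]

section Eval

variable {B : Type*} [NormedCommRing B] [NormOneClass B] [NormedAlgebra K B] [CompleteSpace B]
  [IsUltrametricDist B]

theorem summable_eval (a : σ → B) (ha : ∀ i, ‖a i‖ ≤ 1) (f : TateAlgebra K σ) :
    Summable fun I : σ →₀ ℕ => coeff I f • I.prod fun i n => a i ^ n := by
  refine NonarchimedeanAddGroup.summable_of_tendsto_cofinite_zero ?_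
  refine squeeze_zero_norm (fun I => ?_) (tendsto_zero_iff_norm_tendsto_zero.1 f.tendsto_coeff)
  have h1 : ‖I.prod fun i n => a i ^ n‖ ≤ 1 := by
    refine (Finset.norm_prod_le _ _).trans (Finset.prod_le_one (fun _ _ => norm_nonneg _) ?_)
    exact fun i _ => (norm_pow_le _ _).trans (pow_le_one₀ (norm_nonneg _) (ha i))
  exact (norm_smul_le _ _).trans (mul_le_of_le_one_right (norm_nonneg _) h1)

theorem tsum_eval_mul (a : σ → B) (ha : ∀ i, ‖a i‖ ≤ 1) (f g : TateAlgebra K σ) :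
    (∑' I : σ →₀ ℕ, coeff I (f * g) • I.prod fun i n => a i ^ n) =
      (∑' I : σ →₀ ℕ, coeff I f • I.prod fun i n => a i ^ n) *
        ∑' I : σ →₀ ℕ, coeff I g • I.prod fun i n => a i ^ n := by
  classical
  have hf := summable_eval a ha f
  have hg := summable_eval a ha g
  have : NonarchimedeanRing B :=
    { is_nonarchimedean := NonarchimedeanAddGroup.is_nonarchimedean }
  have hfg := hf.mul_of_nonarchimedean hg
  refine Eq.trans ?_ (hf.tsum_mul_tsum_eq_tsum_sum_antidiagonal hg hfg).symm
  refine tsum_congr fun I => ?_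
  rw [coeff_mul, Finset.sum_smul]
  refine Finset.sum_congr rfl fun q hq => ?_
  have hI : q.1 + q.2 = I := Finset.HasAntidiagonal.mem_antidiagonal.1 hq
  have hp : (I.prod fun i n => a i ^ n) =
      (q.1.prod fun i n => a i ^ n) * q.2.prod fun i n => a i ^ n := by
    rw [← hI]
    exact Finsupp.prod_add_index' (fun i => pow_zero _) (fun i m n => pow_add _ _ _)
  rw [hp, smul_mul_smul_comm]

/-- Substitution `f ↦ f(a) = ∑ c_I a^I` of a tuple `a` of norm at most one in a complete
nonarchimedean `K`-algebra into Tate series. -/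
def aeval (a : σ → B) (ha : ∀ i, ‖a i‖ ≤ 1) : TateAlgebra K σ →ₐ[K] B where
  toFun f := ∑' I : σ →₀ ℕ, coeff I f • I.prod fun i n => a i ^ n
  map_zero' := by simp [coeff_zero]
  map_one' := by
    rw [← map_one (algebraMap K (TateAlgebra K σ)), tsum_eval_algebraMap, map_one]
  map_add' f g := by
    rw [← (summable_eval a ha f).tsum_add (summable_eval a ha g)]
    exact tsum_congr fun I => by rw [coeff_add, add_smul]
  map_mul' := tsum_eval_mul a ha
  commutes' := tsum_eval_algebraMap a

theorem aeval_apply (a : σ → B) (ha : ∀ i, ‖a i‖ ≤ 1) (f : TateAlgebra K σ) :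
    aeval a ha f = ∑' I : σ →₀ ℕ, coeff I f • I.prod fun i n => a i ^ n := rfl

theorem aeval_X (a : σ → B) (ha : ∀ i, ‖a i‖ ≤ 1) (i : σ) :
    aeval (K := K) a ha (X i) = a i := by
  classical
  rw [aeval_apply, tsum_eq_single (Finsupp.single i 1)
    fun I hI => by rw [coeff_X, if_neg hI, zero_smul]]
  simp [coeff_X]

end Eval

/-! ### Homomorphisms between Tate algebras -/

theorem exists_lex_max [LinearOrder σ] {f : TateAlgebra K σ} (hf : f ≠ 0) :
    ∃ J, ‖coeff J f‖ = ‖f‖ ∧ ∀ I, toLex J < toLex I → ‖coeff I f‖ < ‖f‖ := by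
  have hpos : 0 < ‖f‖ := norm_pos_iff.2 hf
  have h := (tendsto_zero_iff_norm_tendsto_zero.1 f.tendsto_coeff).eventually (gt_mem_nhds hpos)
  have hfin : {I | ¬ ‖coeff I f‖ < ‖f‖}.Finite := h
  have hn : hfin.toFinset.Nonempty := by
    obtain ⟨I, hI⟩ := f.exists_norm_coeff_eq
    exact ⟨I, hfin.mem_toFinset.2 (not_lt.2 hI.ge)⟩
  obtain ⟨J, hJ, hJm⟩ := hfin.toFinset.exists_max_image (fun I => toLex I) hn
  refine ⟨J, le_antisymm (norm_coeff_le f J) (not_lt.1 (hfin.mem_toFinset.1 hJ)), fun I hI => ?_⟩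
  by_contra hI'
  exact absurd (hJm I (hfin.mem_toFinset.2 hI')) (not_le.2 hI)

theorem eq_zero_of_isUnit {h : TateAlgebra K σ} (hu : IsUnit h) {J : σ →₀ ℕ}
    (hJ : ‖coeff J h‖ = ‖h‖) : J = 0 := by
  classical
  obtain ⟨_, -⟩ := exists_wellFoundedLT σ
  obtain ⟨k, hk⟩ := hu.exists_right_inv
  have h0 : h ≠ 0 := hu.ne_zero
  have k0 : k ≠ 0 := by rintro rfl; simp at hk
  obtain ⟨J₁, hJ₁, hJ₁m⟩ := exists_lex_max h0
  obtain ⟨J₂, hJ₂, hJ₂m⟩ := exists_lex_max k0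
  have hpos : 0 < ‖h‖ := norm_pos_iff.2 h0
  have kpos : 0 < ‖k‖ := norm_pos_iff.2 k0
  have hle : toLex J ≤ toLex J₁ := not_lt.1 fun hlt => (hJ₁m J hlt).ne hJ
  have key : ‖coeff (J₁ + J₂) (h * k)‖ = ‖coeff J₁ h * coeff J₂ k‖ := by
    rw [coeff_mul]
    refine IsNonarchimedean.apply_sum_eq_of_lt (f := fun x : K => ‖x‖)
      (l := fun q : (σ →₀ ℕ) × (σ →₀ ℕ) => coeff q.1 h * coeff q.2 k) (k := (J₁, J₂))
      IsUltrametricDist.isNonarchimedean_norm (fun a => (norm_neg a).symm)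
      (Finset.HasAntidiagonal.mem_antidiagonal.2 rfl) ?_
    rintro ⟨q₁, q₂⟩ hq hne
    have hq' : q₁ + q₂ = J₁ + J₂ := Finset.HasAntidiagonal.mem_antidiagonal.1 hq
    simp only [norm_mul, hJ₁, hJ₂]
    rcases lt_trichotomy (toLex q₁) (toLex J₁) with hlt | heq | hgt
    · have hgt : toLex J₂ < toLex q₂ := by
        by_contra hcon
        have h2 : toLex q₁ + toLex q₂ < toLex J₁ + toLex J₂ :=
          add_lt_add_of_lt_of_le hlt (not_lt.1 hcon)
        exact absurd (congrArg toLex hq') h2.ne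
      exact mul_lt_mul' (norm_coeff_le h _) (hJ₂m _ hgt) (norm_nonneg _) hpos
    · have h1 : q₁ = J₁ := toLex.injective heq
      subst h1
      exact absurd (by rw [add_left_cancel hq']) hne
    · exact lt_of_le_of_lt (mul_le_mul_of_nonneg_left (norm_coeff_le k q₂) (norm_nonneg _))
        (mul_lt_mul_of_pos_right (hJ₁m _ hgt) kpos)
  have hsum : J₁ + J₂ = 0 := by
    by_contra hne
    rw [hk, coeff_one, if_neg hne, norm_zero, norm_mul, hJ₁, hJ₂] at key
    exact (mul_pos hpos kpos).ne key
  have hJ₁0 : J₁ = 0 := by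
    ext i
    have := DFunLike.congr_fun hsum i
    simp only [Finsupp.add_apply, Finsupp.zero_apply] at this ⊢
    omega
  rw [hJ₁0] at hle
  exact toLex.injective (le_antisymm hle (bot_le (a := toLex J)))

/-- Every `K`-algebra homomorphism between Tate algebras maps the variables to elements of
Gauss norm at most one. -/
theorem norm_map_X_le [CompleteSpace K] {τ : Type*} (φ : TateAlgebra K σ →ₐ[K] TateAlgebra K τ)
    (i : σ) : ‖φ (X i)‖ ≤ 1 := by
  classical
  by_contra! hlt
  obtain ⟨J, hJ⟩ := (φ (X i)).exists_norm_coeff_eq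
  set c := coeff J (φ (X i)) with hc
  have hc1 : 1 < ‖c‖ := by rw [hJ]; exact hlt
  have hc0 : c ≠ 0 := norm_pos_iff.1 (one_pos.trans hc1)
  have hu : IsUnit (1 - c⁻¹ • φ (X i)) := by
    have h1 : ‖c⁻¹ • (X i : TateAlgebra K σ)‖ < 1 := by
      refine (norm_smul_le _ _).trans_lt ?_
      rw [norm_inv]
      exact (mul_le_of_le_one_right (inv_nonneg.2 (norm_nonneg _)) (norm_X_le i)).trans_lt
        (inv_lt_one_of_one_lt₀ hc1)
    have h2 := (isUnit_one_sub_of_norm_lt_one h1).map φ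
    rwa [map_sub, map_one, map_smul] at h2
  have hcoeff : ∀ I, coeff I (1 - c⁻¹ • φ (X i)) =
      (if I = 0 then 1 else 0) - c⁻¹ * coeff I (φ (X i)) := fun I => by
    rw [coeff_sub, coeff_smul, coeff_one]
  have hn : ‖1 - c⁻¹ • φ (X i)‖ ≤ 1 := by
    rw [sub_eq_add_neg]
    refine (norm_add_le_max' _ _).trans (max_le norm_one.le ?_)
    rw [norm_neg]
    refine (norm_smul_le _ _).trans ?_
    rw [norm_inv, ← hJ, inv_mul_cancel₀ (norm_ne_zero_iff.2 hc0)]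
  by_cases hJ0 : J = 0
  · obtain ⟨J', hJ'⟩ := (1 - c⁻¹ • φ (X i)).exists_norm_coeff_eq
    have h0 := eq_zero_of_isUnit hu hJ'
    rw [h0, hcoeff, if_pos rfl, ← hJ0, ← hc, inv_mul_cancel₀ hc0, sub_self, norm_zero] at hJ'
    exact hu.ne_zero (norm_eq_zero.1 hJ'.symm)
  · refine hJ0 (eq_zero_of_isUnit hu (le_antisymm (norm_coeff_le _ _) (hn.trans ?_)))
    rw [hcoeff, if_neg hJ0, ← hc, inv_mul_cancel₀ hc0]
    simp

/-! ### Fibre products of closed balls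

The closed ball `Sp K⟨Z_i : i ∈ σ⟩` has as its `K`-valued functions the Tate algebra, and the
morphisms `Sp A → Sp B` are the `K`-algebra homomorphisms `B → A`. The fibre product of the
balls over `σ` and `τ` is the ball over `σ ⊕ τ`: its algebra `K⟨X, Y⟩` is the completed tensor
product `K⟨X⟩ ⊗̂ K⟨Y⟩`. -/

section Coproduct

variable [CompleteSpace K] {τ ρ σ' τ' : Type*}

/-- Renaming of the variables. -/
def rename (e : σ → τ) : TateAlgebra K σ →ₐ[K] TateAlgebra K τ :=
  aeval (fun i => X (e i)) fun _ => norm_X_le _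

/-- `f ↦ f ⊗ 1`, the first projection of the fibre product. -/
def inl : TateAlgebra K σ →ₐ[K] TateAlgebra K (σ ⊕ τ) := rename Sum.inl

/-- `g ↦ 1 ⊗ g`, the second projection of the fibre product. -/
def inr : TateAlgebra K τ →ₐ[K] TateAlgebra K (σ ⊕ τ) := rename Sum.inr

/-- `f ⊗ g ↦ φ(f) ψ(g)`: the morphism into the fibre product with the given components. -/
def lift (φ : TateAlgebra K σ →ₐ[K] TateAlgebra K ρ) (ψ : TateAlgebra K τ →ₐ[K] TateAlgebra K ρ) :
    TateAlgebra K (σ ⊕ τ) →ₐ[K] TateAlgebra K ρ :=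
  aeval (Sum.elim (fun i => φ (X i)) fun j => ψ (X j)) fun k =>
    k.casesOn (fun i => norm_map_X_le φ i) fun j => norm_map_X_le ψ j

/-- `φ ⊗̂ ψ`, the product of two morphisms. -/
def map (φ : TateAlgebra K σ →ₐ[K] TateAlgebra K σ') (ψ : TateAlgebra K τ →ₐ[K] TateAlgebra K τ') :
    TateAlgebra K (σ ⊕ τ) →ₐ[K] TateAlgebra K (σ' ⊕ τ') :=
  lift (inl.comp φ) (inr.comp ψ)

theorem norm_point_X_le (φ : TateAlgebra K σ →ₐ[K] K) (i : σ) : ‖φ (X i)‖ ≤ 1 :=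
  (AlgHom.norm_apply_le_self φ _).trans (norm_X_le i)

/-- The `K`-rational point `(φ, ψ)` of the fibre product. -/
def liftPoint (φ : TateAlgebra K σ →ₐ[K] K) (ψ : TateAlgebra K τ →ₐ[K] K) :
    TateAlgebra K (σ ⊕ τ) →ₐ[K] K :=
  aeval (Sum.elim (fun i => φ (X i)) fun j => ψ (X j)) fun k =>
    k.casesOn (fun i => norm_point_X_le φ i) fun j => norm_point_X_le ψ j

end Coproduct

end TateAlgebra

end Tate

/-! ## Rigid analytic groups on a closed ball -/

section RigidGroup

open TateAlgebra

variable (K : Type*) [NormedField K] [IsUltrametricDist K] [CompleteSpace K] (σ : Type*)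

/-- A rigid analytic group over `K` whose underlying rigid analytic space is the closed ball
`Sp K⟨Z_i : i ∈ σ⟩`: the multiplication, the unit section and the inversion, given by the
corresponding homomorphisms of affinoid algebras, subject to the axioms of a group object. -/
@[ext]
structure RigidBallGroup where
  /-- multiplication -/
  comul : TateAlgebra K σ →ₐ[K] TateAlgebra K (σ ⊕ σ)
  /-- unit section -/
  counit : TateAlgebra K σ →ₐ[K] K
  /-- inversion -/
  antipode : TateAlgebra K σ →ₐ[K] TateAlgebra K σ
  coassoc : (rename (Equiv.sumAssoc σ σ σ)).comp ((map comul (AlgHom.id K _)).comp comul) =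
    (map (AlgHom.id K _) comul).comp comul
  counit_left : (lift ((Algebra.ofId K _).comp counit) (AlgHom.id K _)).comp comul =
    AlgHom.id K (TateAlgebra K σ)
  counit_right : (lift (AlgHom.id K _) ((Algebra.ofId K _).comp counit)).comp comul =
    AlgHom.id K (TateAlgebra K σ)
  antipode_left : (lift antipode (AlgHom.id K _)).comp comul =
    (Algebra.ofId K (TateAlgebra K σ)).comp counit
  antipode_right : (lift (AlgHom.id K _) antipode).comp comul =
    (Algebra.ofId K (TateAlgebra K σ)).comp counit

namespace RigidBallGroup

variable {K σ}

/-- The product of two `K`-rational points, that is, their image under the multiplication. -/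
def mulPoint (G : RigidBallGroup K σ) (φ ψ : TateAlgebra K σ →ₐ[K] K) : TateAlgebra K σ →ₐ[K] K :=
  (liftPoint φ ψ).comp G.comul

/-- `Θ : O(G') ≃ O(G)`, viewed as an isomorphism of rigid spaces `G → G'`, is an isomorphism of
rigid analytic groups. -/
def IsGroupIso (G G' : RigidBallGroup K σ) (Θ : TateAlgebra K σ ≃ₐ[K] TateAlgebra K σ) : Prop :=
  G.comul.comp Θ.toAlgHom = (map Θ.toAlgHom Θ.toAlgHom).comp G'.comul

end RigidBallGroup

end RigidGroup

/-! ## `p`-valued groups -/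

section PValued

variable (p : ℕ) [Fact p.Prime] (H : Type*) [Group H]

/-- A `p`-valuation on a group, with the convention `ω 1 = ∞`. -/
structure PValuation where
  /-- the function underlying the `p`-valuation -/
  val : H → WithTop ℝ
  val_eq_top_iff : ∀ g, val g = ⊤ ↔ g = 1
  lt_val : ∀ g, ((1 / ((p : ℝ) - 1) : ℝ) : WithTop ℝ) < val g
  min_le_val : ∀ g h, min (val g) (val h) ≤ val (g⁻¹ * h)
  add_le_val_commutator : ∀ g h, val g + val h ≤ val (g * h * g⁻¹ * h⁻¹)
  val_pow : ∀ g, val (g ^ p) = val g + 1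

variable {H} {p}

/-- `ω` defines the topology of `H`: the subgroups `{g | ν ≤ ω g}` form a basis of
neighbourhoods of `1`. -/
def PValuation.DefinesTopology [TopologicalSpace H] (ω : PValuation p H) : Prop :=
  (𝓝 (1 : H)).HasBasis (fun _ : ℝ => True) fun ν => {g | (ν : WithTop ℝ) ≤ ω.val g}

/-- `(H, ω)` is saturated. -/
def PValuation.IsSaturated (ω : PValuation p H) : Prop :=
  ∀ g, (((p : ℝ) / ((p : ℝ) - 1) : ℝ) : WithTop ℝ) < ω.val g → ∃ h, h ^ p = g

open Classical in
/-- The normalized valuation on `ℤ_p`, with `v(p) = 1` and `v(0) = ∞`. -/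
def padicIntVal (x : ℤ_[p]) : WithTop ℝ := if x = 0 then ⊤ else ((x.valuation : ℝ) : WithTop ℝ)

/-- `h ^ x` for `x ∈ ℤ_p`: the limit of `h ^ n` as the integer `n` tends to `x` in `ℤ_p`. -/
def padicPow [TopologicalSpace H] (h : H) (x : ℤ_[p]) : H :=
  haveI : Nonempty H := ⟨1⟩
  limUnder (comap (Int.cast : ℤ → ℤ_[p]) (𝓝 x)) fun n : ℤ => h ^ n

/-- The ordered product `h₁ ^ x₁ ⋯ h_d ^ x_d`. -/
def orderedProd [TopologicalSpace H] {d : ℕ} (h : Fin d → H) (x : Fin d → ℤ_[p]) : H :=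
  (List.ofFn fun i => padicPow (h i) (x i)).prod

/-- An ordered basis `(h₁, …, h_d)` of a `p`-valued group `(H, ω)`. -/
structure OrderedBasis [TopologicalSpace H] (ω : PValuation p H) (d : ℕ) where
  /-- the members of the basis -/
  elt : Fin d → H
  isHomeomorph : IsHomeomorph (orderedProd elt : (Fin d → ℤ_[p]) → H)
  val_orderedProd : ∀ x : Fin d → ℤ_[p], ω.val (orderedProd elt x) =
    Finset.univ.inf fun i => padicIntVal (x i) + ω.val (elt i)

namespace OrderedBasis

variable [TopologicalSpace H] {ω : PValuation p H} {d : ℕ} (b : OrderedBasis ω d)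

/-- The coordinates `(φ(Z₁), …, φ(Z_d)) ∈ ℤ_p^d` of a `ℚ_p`-rational point of the closed ball. -/
def pointCoord (φ : TateAlgebra ℚ_[p] (Fin d) →ₐ[ℚ_[p]] ℚ_[p]) (i : Fin d) : ℤ_[p] :=
  ⟨φ (TateAlgebra.X i), TateAlgebra.norm_point_X_le φ i⟩

/-- The map `φ ↦ h₁ ^ φ(Z₁) ⋯ h_d ^ φ(Z_d)` from the `ℚ_p`-rational points of the closed ball
to `H`. -/
def ofPoint (φ : TateAlgebra ℚ_[p] (Fin d) →ₐ[ℚ_[p]] ℚ_[p]) : H :=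
  orderedProd b.elt (pointCoord φ)

/-- `G` is the rigid analytic group associated with the ordered basis: `φ ↦ ∏ h_i ^ φ(Z_i)` is
an isomorphism of abstract groups `G(ℚ_p) → H`. -/
def IsAssociated (G : RigidBallGroup ℚ_[p] (Fin d)) : Prop :=
  Function.Bijective b.ofPoint ∧ ∀ φ ψ, b.ofPoint (G.mulPoint φ ψ) = b.ofPoint φ * b.ofPoint ψ

/-- The coordinates `x ∈ ℤ_p^d` of `g = h₁ ^ x₁ ⋯ h_d ^ x_d`. -/
def coord (g : H) : Fin d → ℤ_[p] :=
  (Equiv.ofBijective _ b.isHomeomorph.bijective).symm g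

variable (K : Type*) [NormedField K] [IsUltrametricDist K] [CompleteSpace K]
  [NormedAlgebra ℚ_[p] K]

/-- The function `f(h₁ ^ x₁ ⋯ h_d ^ x_d) = ∑ c_I x₁ ^ i₁ ⋯ x_d ^ i_d` on `H` given by a Tate
series `∑ c_I Z^I` over `K`. -/
def toFunction : TateAlgebra K (Fin d) →ₐ[K] (H → K) :=
  AlgHom.pi fun g => TateAlgebra.aeval (fun i => algebraMap ℚ_[p] K (b.coord g i : ℚ_[p]))
    fun i => by rw [norm_algebraMap']; exact (b.coord g i).2

/-- The algebra `C^rig(H, K)` of rigid analytic functions, relative to an ordered basis. -/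
def rigidFunctions : Subalgebra K (H → K) := (b.toFunction K).range

/-- The Gauss norm `sup_I |c_I|` of a function `f` on `H`, relative to an ordered basis: the
infimum over all expansions `∑ c_I Z^I` of `f` (there is at most one). -/
def gaussNorm (f : H → K) : ℝ :=
  sInf {r | ∃ F, b.toFunction K F = f ∧ r = ‖F‖}

end OrderedBasis

end PValued

end

/-!
Everything rests on one analytic fact (`OrderedBasis.exists_tate_coord`): if `g₁, …, g_n ∈ H` and
`P : ℤ_p^n → H` is a continuous map with `P(a) = g₁ ^ a₁ ⋯ g_n ^ a_n` for natural numbers `a_i`,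
then the coordinates of `P(x)` with respect to an ordered basis are Tate series in `x` of Gauss
norm at most `1`. Multiplication, inversion and change of basis are all maps of this kind.

To prove it, extend the `k`-th coordinate linearly to `λ_k : ℤ[H] → ℤ_p`. Expanding
`g ^ a = (1 + (g - 1)) ^ a` gives the Newton series

`λ_k (P(x)) = ∑_α λ_k ((g₁ - 1) ^ α₁ ⋯ (g_n - 1) ^ α_n) ∏ binom(x_i, α_i)`,

so it suffices that the Newton coefficient divided by `α!` is integral and tends to `0`.

* The group ring is filtered by weight: `p ^ m (y₁ - 1) ⋯ (y_s - 1)` has weight `m + ω(y₁) + ⋯ +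
  ω(y_s)`. Modulo arbitrarily high weight, an element of weight at least `ν` is a combination of
  ordered monomials in the `h_i - 1` of weight at least `ν`, because commutators raise the weight
  (`PValuation.IsFrame.augFiltration_le_monomialSpan`).
* `λ_k` is small on elements of very high weight: `λ_k` modulo `p ^ N` factors through the group
  ring of a finite `p`-group, whose augmentation ideal is nilpotent modulo `p ^ N`
  (`exists_prod_map_sub_one_eq_zero`, `PValuation.DefinesTopology.exists_dvd_linExt`).
* `λ_k` sends an ordered monomial in the `h_i - 1` to `1` if it is `h_k - 1`, and otherwise to
  `0`. Together, `λ_k` of an element of weight `ν` has valuation at least `ν - ω(h_k)`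
  (`OrderedBasis.pow_dvd_linExt_coord`).
* Since `ω > 1 / (p - 1)`, while saturation bounds `ω(h_k)` by `p / (p - 1)`
  (`OrderedBasis.weight_le`), Legendre's formula for the valuation of `α!` gives the estimate.

The rest is formal. A Tate series vanishing on `ℤ_p^n` is zero
(`TateAlgebra.eq_zero_of_evalInt_eq_zero`), and every algebra homomorphism from a Tate algebra to
`ℚ_p` is continuous, hence determined by the images of the variables (`TateAlgebra.point_ext`). So
homomorphisms between Tate algebras are determined by the maps on rational points, and every group
axiom and every uniqueness assertion may be checked in `H`. The coordinate change between two
ordered bases is given by Tate series of norm at most `1`; substituting them does not increase the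
Gauss norm, in either direction, so both the algebra of rigid functions and its norm do not depend
on the basis.
-/

noncomputable section

/-! ### Augmentation ideals of finite `p`-groups -/

section Augmentation

/-- Finite `p`-groups act unipotently in characteristic `p ^ M`: products of sufficiently many
`ψ q - 1` vanish in a finite ring of `p`-power order. Such products are iterated commutators in the
finite `p`-group `R ⋊ Q`, which is nilpotent. -/
theorem exists_prod_map_sub_one_eq_zero {p : ℕ} [Fact p.Prime] {R Q : Type*} [Ring R] [Finite R]
    [Group Q] [Finite Q] (hR : IsPGroup p (Multiplicative R)) (hQ : IsPGroup p Q) (ψ : Q →* R) :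
    ∃ n, ∀ l : List Q, n ≤ l.length → (l.map fun q => ψ q - 1).prod = 0 := by
  let φ : Q →* MulAut (Multiplicative R) :=
    { toFun := fun q =>
        { toFun := fun v => Multiplicative.ofAdd (ψ q * v.toAdd)
          invFun := fun v => Multiplicative.ofAdd (ψ q⁻¹ * v.toAdd)
          left_inv := fun v => by simp [← mul_assoc, ← map_mul]
          right_inv := fun v => by simp [← mul_assoc, ← map_mul]
          map_mul' := fun v w => by simp [mul_add] }
      map_one' := by ext; simp
      map_mul' := fun q r => by ext; simp [mul_assoc] }
  have hφ : ∀ q v, φ q v = Multiplicative.ofAdd (ψ q * v.toAdd) := fun _ _ => rfl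
  have hfin : Finite (Multiplicative R ⋊[φ] Q) := Finite.of_equiv _ SemidirectProduct.equivProd.symm
  have hp : IsPGroup p (Multiplicative R ⋊[φ] Q) := by
    obtain ⟨a, ha⟩ := IsPGroup.iff_card.1 hR
    obtain ⟨b, hb⟩ := IsPGroup.iff_card.1 hQ
    exact IsPGroup.of_card (n := a + b) (by rw [SemidirectProduct.card, ha, hb, pow_add])
  obtain ⟨n, hn⟩ := Subgroup.nilpotent_iff_lowerCentralSeries.1 hp.isNilpotent
  -- `(q - 1) v` is the commutator of `q` and `v` in the semidirect product
  have key : ∀ l : List Q, SemidirectProduct.inl (φ := φ)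
      (Multiplicative.ofAdd (l.map fun q => ψ q - 1).prod) ∈
        Subgroup.lowerCentralSeries (⊤ : Subgroup (Multiplicative R ⋊[φ] Q)) l.length := by
    intro l
    induction l with
    | nil => simp
    | cons q l ih =>
      rw [List.length_cons, Subgroup.lowerCentralSeries_succ, Subgroup.commutator_comm]
      have h := Subgroup.commutator_mem_commutator
        (Subgroup.mem_top (SemidirectProduct.inr (φ := φ) q)) ih
      convert h using 1
      rw [commutatorElement_def, ← map_inv SemidirectProduct.inr]
      rw [← SemidirectProduct.inl_aut, ← map_inv SemidirectProduct.inl, ← map_mul, hφ]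
      congr 1
      rw [List.map_cons, List.prod_cons, sub_mul, one_mul, sub_eq_add_neg]
      rfl
  refine ⟨n, fun l hl => ?_⟩
  have h := Subgroup.lowerCentralSeries_antitone _ hl (key l)
  rw [hn, Subgroup.mem_bot] at h
  have h1 := SemidirectProduct.inl_injective (h.trans (map_one _).symm)
  exact h1

end Augmentation

/-! ### Newton expansions in a group ring -/

section Newton

theorem pow_eq_sum_choose {R : Type*} [Ring R] (u : R) {a N : ℕ} (h : a ≤ N) :
    u ^ a = ∑ n : Fin (N + 1), (a.choose n : R) * (u - 1) ^ (n : ℕ) := by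
  have h1 : u ^ a = ((u - 1) + 1) ^ a := by rw [sub_add_cancel]
  rw [h1, (Commute.one_right (u - 1)).add_pow,
    Finset.sum_range (fun m => (u - 1) ^ m * 1 ^ (a - m) * (a.choose m : R)),
    Fin.sum_univ_eq_sum_range (fun m => (u - 1) ^ m * 1 ^ (a - m) * (a.choose m : R)),
    Fin.sum_univ_eq_sum_range (fun m => (a.choose m : R) * (u - 1) ^ m)]
  have h2 : Finset.range (a + 1) ⊆ Finset.range (N + 1) := by
    intro x; simp only [Finset.mem_range]; omega
  rw [← Finset.sum_subset h2]
  · exact Finset.sum_congr rfl fun m _ => by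
      rw [one_pow, mul_one, (Nat.cast_commute _ _).eq]
  · intro m _ hm
    rw [Nat.choose_eq_zero_of_lt (by simpa [Nat.lt_succ_iff] using hm)]
    simp

/-- The Newton expansion of an ordered product of powers. -/
theorem prod_ofFn_pow_eq_sum {R : Type*} [Ring R] {n : ℕ} (u : Fin n → R) (a : Fin n → ℕ) {N : ℕ}
    (h : ∀ i, a i ≤ N) :
    (List.ofFn fun i => u i ^ a i).prod = ∑ α : Fin n → Fin (N + 1),
      ((∏ i, (a i).choose (α i) : ℕ) : R) * (List.ofFn fun i => (u i - 1) ^ (α i : ℕ)).prod := by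
  induction n with
  | zero => simp
  | succ n ih =>
    rw [List.ofFn_succ, List.prod_cons, ih _ _ fun i => h i.succ, pow_eq_sum_choose (u 0) (h 0),
      Finset.sum_mul_sum, ← Fintype.sum_prod_type'
        (f := fun (x : Fin (N + 1)) (y : Fin n → Fin (N + 1)) =>
          ((a 0).choose x : R) * (u 0 - 1) ^ (x : ℕ) *
          (((∏ i : Fin n, (a i.succ).choose (y i) : ℕ) : R) *
            (List.ofFn fun i => (u i.succ - 1) ^ (y i : ℕ)).prod)),
      ← (Fin.consEquiv fun _ => Fin (N + 1)).sum_comp]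
    refine Finset.sum_congr rfl fun q _ => ?_
    rw [List.ofFn_succ, List.prod_cons, Fin.prod_univ_succ]
    simp only [Fin.consEquiv_apply, Fin.cons_zero, Fin.cons_succ]
    rw [Nat.cast_mul, mul_assoc, mul_assoc, ← mul_assoc ((u 0 - 1) ^ _),
      ← (Nat.cast_commute _ ((u 0 - 1) ^ (q.1 : ℕ))).eq, mul_assoc]

end Newton

/-! ### Valuations of binomial coefficients -/

section Binomial

variable {p : ℕ} [hp : Fact p.Prime]

theorem sub_one_mul_le_of_pow_dvd {n k : ℕ} (hn : n ≠ 0) (h : p ^ k ∣ n) :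
    (p - 1) * k ≤ n - 1 := by
  have h1 : p ^ k ≤ n := Nat.le_of_dvd (Nat.pos_of_ne_zero hn) h
  have h2 := one_add_mul_le_pow (show (-2 : ℤ) ≤ (p : ℤ) - 1 by omega) k
  have h3 := hp.out.one_lt
  zify [h3.le, Nat.one_le_iff_ne_zero.2 hn] at h1 ⊢
  have : (1 + ((p : ℤ) - 1)) = p := by ring
  rw [this] at h2
  nlinarith

/-- `v(binom(a, n)) ≥ v(a) - v(n)`, and `v(n) ≤ (n - 1) / (p - 1)`. -/
theorem exists_pow_dvd_choose {a k n : ℕ} (ha : p ^ k ∣ a) (hn : n ≠ 0) :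
    ∃ m, p ^ m ∣ a.choose n ∧ (p - 1) * k ≤ (p - 1) * m + (n - 1) := by
  rcases Nat.eq_zero_or_pos a with rfl | hapos
  · exact ⟨k, by rw [Nat.choose_eq_zero_of_lt (Nat.pos_of_ne_zero hn)]; exact dvd_zero _, by omega⟩
  obtain ⟨n, rfl⟩ := Nat.exists_eq_succ_of_ne_zero hn
  obtain ⟨a, rfl⟩ := Nat.exists_eq_succ_of_ne_zero hapos.ne'
  have h1 := Nat.add_one_mul_choose_eq a n
  obtain ⟨t, c, hc, hn'⟩ := Nat.exists_eq_pow_mul_and_not_dvd hn p hp.out.ne_one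
  have h2 := sub_one_mul_le_of_pow_dvd (p := p) hn (hn' ▸ dvd_mul_right _ _ : p ^ t ∣ n.succ)
  -- `n binom(a, n) = a binom(a - 1, n - 1)`, so `p ^ (k - t)` divides `binom(a, n)` for `t = v(n)`
  refine ⟨k - t, ?_, ?_⟩
  · have h3 : p ^ k ∣ (a.succ).choose n.succ * (p ^ t * c) := by
      rw [← hn']; exact h1 ▸ ha.mul_right _
    have hcop : Nat.Coprime (p ^ k) c :=
      Nat.Coprime.pow_left _ ((Nat.Prime.coprime_iff_not_dvd hp.out).2 hc)
    rw [← mul_assoc] at h3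
    have h4 := hcop.dvd_of_dvd_mul_right h3
    rcases le_total k t with hkt | hkt
    · rw [Nat.sub_eq_zero_of_le hkt, pow_zero]; exact one_dvd _
    · obtain ⟨s, rfl⟩ := Nat.exists_eq_add_of_le hkt
      rw [Nat.add_sub_cancel_left]
      rw [pow_add, mul_comm] at h4
      exact Nat.dvd_of_mul_dvd_mul_right (pow_pos hp.out.pos t) h4
  · rcases le_total k t with hkt | hkt
    · have := Nat.mul_le_mul_left (p - 1) hkt
      omega
    · obtain ⟨s, rfl⟩ := Nat.exists_eq_add_of_le hkt
      rw [Nat.add_sub_cancel_left, mul_add]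
      omega

end Binomial

/-! ### The filtration of the group ring -/

section Filtration

variable {p : ℕ} {H : Type*} [Group H]

namespace PValuation

variable (ω : PValuation p H)

/-- The additive subgroup of `ℤ[H]` spanned by the products `p ^ m (g₁ - 1) ⋯ (g_n - 1)` of weight
`m + ω g₁ + ⋯ + ω g_n` at least `ν`. The weights enter through real lower bounds `r_i ≤ ω g_i`,
since `ω` takes the value `∞`. -/
def augFiltration (ν : ℝ) : AddSubgroup (MonoidAlgebra ℤ H) :=
  AddSubgroup.closure {u | ∃ (m : ℕ) (l : List (H × ℝ)),
    (∀ q ∈ l, (q.2 : WithTop ℝ) ≤ ω.val q.1) ∧ ν ≤ m + (l.map Prod.snd).sum ∧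
    u = (p : MonoidAlgebra ℤ H) ^ m * (l.map fun q => MonoidAlgebra.of ℤ H q.1 - 1).prod}

variable {ω}

theorem augFiltration_antitone {ν μ : ℝ} (h : ν ≤ μ) : ω.augFiltration μ ≤ ω.augFiltration ν :=
  AddSubgroup.closure_mono fun _ ⟨m, l, h1, h2, h3⟩ => ⟨m, l, h1, h.trans h2, h3⟩

theorem mul_mem_augFiltration {ν μ : ℝ} {u v : MonoidAlgebra ℤ H} (hu : u ∈ ω.augFiltration ν)
    (hv : v ∈ ω.augFiltration μ) : u * v ∈ ω.augFiltration (ν + μ) := by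
  induction hu using AddSubgroup.closure_induction with
  | zero => simp
  | add x y _ _ hx hy => rw [add_mul]; exact add_mem hx hy
  | neg x _ hx => rw [neg_mul]; exact neg_mem hx
  | mem x hx =>
    obtain ⟨m, l, h1, h2, rfl⟩ := hx
    induction hv using AddSubgroup.closure_induction with
    | zero => simp
    | add x y _ _ hx hy => rw [mul_add]; exact add_mem hx hy
    | neg x _ hx => rw [mul_neg]; exact neg_mem hx
    | mem x hx =>
      obtain ⟨m', l', h1', h2', rfl⟩ := hx
      refine AddSubgroup.subset_closure ⟨m + m', l ++ l', ?_, ?_, ?_⟩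
      · intro q hq
        exact (List.mem_append.1 hq).elim (h1 q) (h1' q)
      · rw [List.map_append, List.sum_append]; push_cast; linarith
      · rw [List.map_append, List.prod_append, pow_add, mul_assoc, mul_assoc,
          ← mul_assoc (l.map _).prod, ← ((Nat.cast_commute p _).pow_left m').eq, mul_assoc]

theorem prime_pow_mem_augFiltration (m : ℕ) :
    (p : MonoidAlgebra ℤ H) ^ m ∈ ω.augFiltration m :=
  AddSubgroup.subset_closure ⟨m, [], by simp, by simp, by simp⟩

theorem of_sub_one_mem_augFiltration {g : H} {r : ℝ} (h : (r : WithTop ℝ) ≤ ω.val g) :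
    MonoidAlgebra.of ℤ H g - 1 ∈ ω.augFiltration r :=
  AddSubgroup.subset_closure ⟨0, [(g, r)], by simpa using h, by simp, by simp⟩

theorem one_mem_augFiltration : (1 : MonoidAlgebra ℤ H) ∈ ω.augFiltration 0 := by
  simpa using prime_pow_mem_augFiltration (ω := ω) 0

theorem natCast_mem_augFiltration {k a : ℕ} (h : p ^ k ∣ a) :
    (a : MonoidAlgebra ℤ H) ∈ ω.augFiltration k := by
  obtain ⟨c, rfl⟩ := h
  have := (ω.augFiltration k).nsmul_mem (prime_pow_mem_augFiltration (ω := ω) k) c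
  rw [nsmul_eq_mul] at this
  rwa [mul_comm, Nat.cast_mul, Nat.cast_pow]

theorem pow_mem_augFiltration {ν : ℝ} {u : MonoidAlgebra ℤ H} (hu : u ∈ ω.augFiltration ν)
    (n : ℕ) : u ^ n ∈ ω.augFiltration (n * ν) := by
  induction n with
  | zero => simpa using one_mem_augFiltration
  | succ n ih =>
    rw [pow_succ]
    have := mul_mem_augFiltration ih hu
    rwa [show (n : ℝ) * ν + ν = ((n + 1 : ℕ) : ℝ) * ν by push_cast; ring] at this

theorem prod_mem_augFiltration {ρ : ℝ} (l : List (MonoidAlgebra ℤ H))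
    (h : ∀ u ∈ l, u ∈ ω.augFiltration ρ) : l.prod ∈ ω.augFiltration (l.length * ρ) := by
  induction l with
  | nil => simpa using one_mem_augFiltration
  | cons u l ih =>
    rw [List.prod_cons, List.length_cons]
    have := mul_mem_augFiltration (h u (by simp)) (ih fun v hv => h v (by simp [hv]))
    rwa [show ρ + (l.length : ℝ) * ρ = ((l.length + 1 : ℕ) : ℝ) * ρ by push_cast; ring] at this

end PValuation

end Filtration

/-! ### Straightening of words -/

section Straightening

variable {p : ℕ} {H : Type*} [Group H] {d : ℕ}

/-- The additive span of the `p ^ m (h_{i₁} - 1) ⋯ (h_{i_k} - 1)` with `k < n` of weight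
`m + w_{i₁} + ⋯ + w_{i_k}` at least `ν`. -/
def wordSpan (p : ℕ) (h : Fin d → H) (w : Fin d → ℝ) (n : ℕ) (ν : ℝ) :
    AddSubgroup (MonoidAlgebra ℤ H) :=
  AddSubgroup.closure {u | ∃ (m : ℕ) (l : List (Fin d)), l.length < n ∧
    ν ≤ m + (l.map w).sum ∧
    u = (p : MonoidAlgebra ℤ H) ^ m * (l.map fun i => MonoidAlgebra.of ℤ H (h i) - 1).prod}

/-- The additive span of the ordered monomials `p ^ m (h₁ - 1) ^ γ₁ ⋯ (h_d - 1) ^ γ_d` of weight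
`m + γ₁ w₁ + ⋯ + γ_d w_d` at least `ν`. -/
def monomialSpan (p : ℕ) (h : Fin d → H) (w : Fin d → ℝ) (ν : ℝ) :
    AddSubgroup (MonoidAlgebra ℤ H) :=
  AddSubgroup.closure {u | ∃ (m : ℕ) (γ : Fin d → ℕ), ν ≤ m + ∑ i, (γ i : ℝ) * w i ∧
    u = (p : MonoidAlgebra ℤ H) ^ m *
      (List.ofFn fun i => (MonoidAlgebra.of ℤ H (h i) - 1) ^ γ i).prod}

theorem wordSpan_mono {h : Fin d → H} {w : Fin d → ℝ} {n n' : ℕ} {ν ν' : ℝ} (hn : n ≤ n')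
    (hν : ν' ≤ ν) : wordSpan p h w n ν ≤ wordSpan p h w n' ν' :=
  AddSubgroup.closure_mono fun _ ⟨m, l, h1, h2, h3⟩ => ⟨m, l, h1.trans_le hn, hν.trans h2, h3⟩

theorem mul_mem_wordSpan {h : Fin d → H} {w : Fin d → ℝ} {n n' : ℕ} {ν μ : ℝ}
    {u v : MonoidAlgebra ℤ H} (hu : u ∈ wordSpan p h w (n + 1) ν) (hv : v ∈ wordSpan p h w n' μ) :
    u * v ∈ wordSpan p h w (n + n') (ν + μ) := by
  induction hu using AddSubgroup.closure_induction with
  | zero => simp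
  | add x y _ _ hx hy => rw [add_mul]; exact add_mem hx hy
  | neg x _ hx => rw [neg_mul]; exact neg_mem hx
  | mem x hx =>
    obtain ⟨m, l, h1, h2, rfl⟩ := hx
    induction hv using AddSubgroup.closure_induction with
    | zero => simp
    | add x y _ _ hx hy => rw [mul_add]; exact add_mem hx hy
    | neg x _ hx => rw [mul_neg]; exact neg_mem hx
    | mem x hx =>
      obtain ⟨m', l', h1', h2', rfl⟩ := hx
      refine AddSubgroup.subset_closure ⟨m + m', l ++ l', ?_, ?_, ?_⟩
      · rw [List.length_append]; omega
      · rw [List.map_append, List.sum_append]; push_cast; linarith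
      · rw [List.map_append, List.prod_append, pow_add, mul_assoc, mul_assoc,
          ← mul_assoc (l.map _).prod, ← ((Nat.cast_commute p _).pow_left m').eq, mul_assoc]

namespace PValuation

variable (ω : PValuation p H)

/-- Words of length less than `n` and weight at least `ν`, modulo elements of weight at least
`ν + ε`. -/
def wordSup (h : Fin d → H) (w : Fin d → ℝ) (ε : ℝ) (n : ℕ) (ν : ℝ) :
    AddSubgroup (MonoidAlgebra ℤ H) :=
  wordSpan p h w n ν ⊔ ω.augFiltration (ν + ε)

/-- A real number `ε > 0` and a tuple `h` of elements with finite values `w` exceeding `1 / (p - 1)`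
by at least `ε`, whose ordered products with natural exponents of the expected weights approximate
every element of the group. -/
structure IsFrame (h : Fin d → H) (w : Fin d → ℝ) (ε : ℝ) : Prop where
  val_eq : ∀ i, ω.val (h i) = w i
  pos : 0 < ε
  le_inv : ε ≤ 1 / ((p : ℝ) - 1)
  add_le : ∀ i, 1 / ((p : ℝ) - 1) + ε ≤ w i
  exists_approx : ∀ (g : H) (r : ℝ), (r : WithTop ℝ) ≤ ω.val g → ∃ a : Fin d → ℕ,
    (∀ i, ∃ k : ℕ, p ^ k ∣ a i ∧ r ≤ k + w i) ∧
    ((r + ε : ℝ) : WithTop ℝ) ≤ ω.val ((List.ofFn fun i => h i ^ a i).prod⁻¹ * g)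

variable {ω} {h : Fin d → H} {w : Fin d → ℝ} {ε : ℝ}

theorem wordSup_mono {n n' : ℕ} {ν ν' : ℝ} (hn : n ≤ n') (hν : ν' ≤ ν) :
    ω.wordSup h w ε n ν ≤ ω.wordSup h w ε n' ν' :=
  sup_le_sup (wordSpan_mono hn hν) (augFiltration_antitone (by linarith))

theorem word_mem_augFiltration (hval : ∀ i, ω.val (h i) = w i) (l : List (Fin d)) :
    (l.map fun i => MonoidAlgebra.of ℤ H (h i) - 1).prod ∈ ω.augFiltration (l.map w).sum :=
  AddSubgroup.subset_closure ⟨0, l.map fun i => (h i, w i), by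
    intro q hq
    obtain ⟨i, -, rfl⟩ := List.mem_map.1 hq
    exact (hval i).ge, by simp [Function.comp_def], by simp [Function.comp_def]⟩

theorem prime_pow_mem_wordSup (m : ℕ) :
    (p : MonoidAlgebra ℤ H) ^ m ∈ ω.wordSup h w ε 1 m :=
  AddSubgroup.mem_sup_left (AddSubgroup.subset_closure ⟨m, [], by simp, by simp, by simp⟩)

theorem word_mem_wordSup (l : List (Fin d)) :
    (l.map fun i => MonoidAlgebra.of ℤ H (h i) - 1).prod ∈
      ω.wordSup h w ε (l.length + 1) (l.map w).sum :=
  AddSubgroup.mem_sup_left (AddSubgroup.subset_closure ⟨0, l, by simp, by simp, by simp⟩)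

theorem letter_mem_wordSup (i : Fin d) :
    MonoidAlgebra.of ℤ H (h i) - 1 ∈ ω.wordSup h w ε 2 (w i) := by
  simpa using word_mem_wordSup (ω := ω) (h := h) (w := w) (ε := ε) [i]

namespace IsFrame

variable (F : ω.IsFrame h w ε)
include F

theorem wordSpan_le (n : ℕ) (ν : ℝ) : wordSpan p h w n ν ≤ ω.augFiltration ν := by
  refine (AddSubgroup.closure_le _).2 ?_
  rintro _ ⟨m, l, -, h2, rfl⟩
  exact augFiltration_antitone h2
    (mul_mem_augFiltration (prime_pow_mem_augFiltration m) (word_mem_augFiltration F.val_eq l))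

theorem wordSup_le (n : ℕ) (ν : ℝ) : ω.wordSup h w ε n ν ≤ ω.augFiltration ν :=
  sup_le (F.wordSpan_le n ν) (augFiltration_antitone (by linarith [F.pos]))

theorem mul_mem_wordSup {n n' : ℕ} {ν μ : ℝ} {u v : MonoidAlgebra ℤ H}
    (hu : u ∈ ω.wordSup h w ε (n + 1) ν) (hv : v ∈ ω.wordSup h w ε n' μ) :
    u * v ∈ ω.wordSup h w ε (n + n') (ν + μ) := by
  have hv' := F.wordSup_le _ _ hv
  obtain ⟨u₁, hu₁, u₂, hu₂, rfl⟩ := AddSubgroup.mem_sup.1 hu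
  obtain ⟨v₁, hv₁, v₂, hv₂, rfl⟩ := AddSubgroup.mem_sup.1 hv
  rw [add_mul, mul_add, add_assoc]
  refine add_mem (AddSubgroup.mem_sup_left (mul_mem_wordSpan hu₁ hv₁))
    (AddSubgroup.mem_sup_right (add_mem ?_ ?_))
  · exact augFiltration_antitone (by linarith) (mul_mem_augFiltration (F.wordSpan_le _ _ hu₁) hv₂)
  · exact augFiltration_antitone (by linarith) (mul_mem_augFiltration hu₂ hv')

/-- In the Newton expansion of `h_i ^ a` all terms but the linear one gain at least `ε`. -/
theorem pow_sub_one_mem_wordSup [Fact p.Prime] {i : Fin d} {a k : ℕ} {r : ℝ} (hk : p ^ k ∣ a)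
    (hr : r ≤ k + w i) : MonoidAlgebra.of ℤ H (h i) ^ a - 1 ∈ ω.wordSup h w ε 2 r := by
  rw [pow_eq_sum_choose (MonoidAlgebra.of ℤ H (h i)) le_rfl, Fin.sum_univ_succ]
  simp only [Fin.val_zero, Nat.choose_zero_right, Nat.cast_one, pow_zero, mul_one, Fin.val_succ,
    add_sub_cancel_left]
  refine sum_mem fun n _ => ?_
  rcases Nat.eq_zero_or_pos (n : ℕ) with hn | hn
  · rw [hn, Nat.choose_one_right, pow_one]
    obtain ⟨c, rfl⟩ := hk
    have h1 := F.mul_mem_wordSup (prime_pow_mem_wordSup k) (letter_mem_wordSup i)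
    have h2 := (AddSubgroup.nsmul_mem _ h1 c)
    rw [nsmul_eq_mul, ← mul_assoc] at h2
    rw [Nat.cast_mul, Nat.cast_pow, ← Nat.cast_comm]
    exact wordSup_mono le_rfl hr h2
  · refine AddSubgroup.mem_sup_right ?_
    obtain ⟨m, hm, hle⟩ := exists_pow_dvd_choose (p := p) hk (Nat.succ_ne_zero (n : ℕ))
    have h1 := mul_mem_augFiltration (natCast_mem_augFiltration (ω := ω) hm)
      (pow_mem_augFiltration (of_sub_one_mem_augFiltration (F.val_eq i).ge) (n + 1))
    refine augFiltration_antitone ?_ h1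
    have hp : (1 : ℝ) < p := by exact_mod_cast (Fact.out : p.Prime).one_lt
    have hle' : ((p : ℝ) - 1) * k ≤ (p - 1) * m + n := by
      have h3 : (((p - 1) * k : ℕ) : ℝ) ≤ (((p - 1) * m + (n + 1 - 1) : ℕ) : ℝ) := by
        exact_mod_cast hle
      rw [Nat.add_sub_cancel] at h3
      push_cast [Nat.cast_sub (Fact.out : p.Prime).one_lt.le] at h3
      exact h3
    have h4 : (k : ℝ) ≤ m + n * (1 / ((p : ℝ) - 1)) := by
      rw [mul_one_div, ← sub_le_iff_le_add', le_div_iff₀ (by linarith)]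
      linarith
    have hn' : (1 : ℝ) ≤ n := by exact_mod_cast hn
    have h5 := F.add_le i
    push_cast
    nlinarith [F.pos]

theorem prod_sub_one_mem_wordSup {r : ℝ} (hr : ε ≤ r) (l : List (MonoidAlgebra ℤ H))
    (hl : ∀ u ∈ l, u - 1 ∈ ω.wordSup h w ε 2 r) : l.prod - 1 ∈ ω.wordSup h w ε 2 r := by
  induction l with
  | nil => simp
  | cons u l ih =>
    have hu := hl u (by simp)
    have ht := ih fun v hv => hl v (by simp [hv])
    rw [List.prod_cons, show u * l.prod - 1 = (u - 1) + (l.prod - 1) + (u - 1) * (l.prod - 1) by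
      noncomm_ring]
    refine add_mem (add_mem hu ht) (AddSubgroup.mem_sup_right ?_)
    exact augFiltration_antitone (by linarith)
      (mul_mem_augFiltration (F.wordSup_le _ _ hu) (F.wordSup_le _ _ ht))

/-- `g - 1` is a linear combination of the `h_i - 1` of the same weight, up to a gain of `ε`. -/
theorem of_sub_one_mem_wordSup [Fact p.Prime] {g : H} {r : ℝ} (hg : (r : WithTop ℝ) ≤ ω.val g) :
    MonoidAlgebra.of ℤ H g - 1 ∈ ω.wordSup h w ε 2 r := by
  -- products of two elements of weight `r` gain `ε` only if `r ≥ ε`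
  have hεg : ((max r ε : ℝ) : WithTop ℝ) ≤ ω.val g := by
    rw [WithTop.coe_max]
    exact max_le hg ((WithTop.coe_le_coe.2 F.le_inv).trans (ω.lt_val g).le)
  refine wordSup_mono le_rfl (le_max_left r ε) ?_
  obtain ⟨a, ha, hag⟩ := F.exists_approx g _ hεg
  set t := (List.ofFn fun i => h i ^ a i).prod with ht
  have h1 : MonoidAlgebra.of ℤ H g - 1 = (MonoidAlgebra.of ℤ H t - 1) +
      ((MonoidAlgebra.of ℤ H (t⁻¹ * g) - 1) +
        (MonoidAlgebra.of ℤ H t - 1) * (MonoidAlgebra.of ℤ H (t⁻¹ * g) - 1)) := by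
    have h2 : MonoidAlgebra.of ℤ H g =
        MonoidAlgebra.of ℤ H t * MonoidAlgebra.of ℤ H (t⁻¹ * g) := by
      rw [← map_mul, mul_inv_cancel_left]
    rw [h2]
    noncomm_ring
  have h2 : MonoidAlgebra.of ℤ H t - 1 ∈ ω.wordSup h w ε 2 (max r ε) := by
    rw [ht, map_list_prod, List.map_ofFn]
    refine F.prod_sub_one_mem_wordSup (le_max_right _ _) _ fun u hu => ?_
    obtain ⟨i, rfl⟩ := List.mem_ofFn.1 hu
    obtain ⟨k, hk, hk'⟩ := ha i
    rw [Function.comp_apply, map_pow]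
    exact F.pow_sub_one_mem_wordSup hk hk'
  rw [h1]
  have h3 := of_sub_one_mem_augFiltration hag
  refine add_mem h2 (AddSubgroup.mem_sup_right (add_mem h3 ?_))
  refine augFiltration_antitone ?_ (mul_mem_augFiltration (F.wordSup_le _ _ h2) h3)
  linarith [F.pos, le_max_right r ε]

/-- Every element of weight at least `ν` is a combination of words in the `h_i - 1`, up to a gain
of `ε`. -/
theorem exists_mem_wordSup [Fact p.Prime] {ν : ℝ} {u : MonoidAlgebra ℤ H}
    (hu : u ∈ ω.augFiltration ν) : ∃ n, u ∈ ω.wordSup h w ε n ν := by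
  induction hu using AddSubgroup.closure_induction with
  | zero => exact ⟨0, zero_mem _⟩
  | add x y _ _ hx hy =>
    obtain ⟨n, hn⟩ := hx
    obtain ⟨m, hm⟩ := hy
    exact ⟨max n m, add_mem (wordSup_mono (le_max_left _ _) le_rfl hn)
      (wordSup_mono (le_max_right _ _) le_rfl hm)⟩
  | neg x _ hx =>
    obtain ⟨n, hn⟩ := hx
    exact ⟨n, neg_mem hn⟩
  | mem x hx =>
    obtain ⟨m, l, h1, h2, rfl⟩ := hx
    have key : (l.map fun q => MonoidAlgebra.of ℤ H q.1 - 1).prod ∈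
        ω.wordSup h w ε (l.length + 1) (l.map Prod.snd).sum := by
      clear h2
      induction l with
      | nil => simpa using word_mem_wordSup []
      | cons q l ih =>
        simp only [List.map_cons, List.prod_cons, List.sum_cons, List.length_cons]
        rw [add_comm l.length 1, add_assoc]
        exact F.mul_mem_wordSup (F.of_sub_one_mem_wordSup (h1 q (by simp)))
          (ih fun q' hq' => h1 q' (by simp [hq']))
    exact ⟨_, wordSup_mono le_rfl h2 (F.mul_mem_wordSup (prime_pow_mem_wordSup m) key)⟩

/-- Exchanging two letters costs a commutator, whose augmentation is a combination of single
letters of the same weight. -/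
theorem swap_sub_mem_wordSup [Fact p.Prime] (i j : Fin d) :
    (MonoidAlgebra.of ℤ H (h i) - 1) * (MonoidAlgebra.of ℤ H (h j) - 1) -
      (MonoidAlgebra.of ℤ H (h j) - 1) * (MonoidAlgebra.of ℤ H (h i) - 1) ∈
      ω.wordSup h w ε 2 (w i + w j) := by
  set c := h i * h j * (h i)⁻¹ * (h j)⁻¹ with hc
  have hcv : ((w i + w j : ℝ) : WithTop ℝ) ≤ ω.val c := by
    rw [WithTop.coe_add, ← F.val_eq, ← F.val_eq]
    exact ω.add_le_val_commutator _ _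
  have h1 : MonoidAlgebra.of ℤ H (h i) * MonoidAlgebra.of ℤ H (h j) =
      MonoidAlgebra.of ℤ H c * (MonoidAlgebra.of ℤ H (h j) * MonoidAlgebra.of ℤ H (h i)) := by
    rw [← map_mul, ← map_mul, ← map_mul, hc]
    congr 1
    group
  have h2 : (MonoidAlgebra.of ℤ H (h i) - 1) * (MonoidAlgebra.of ℤ H (h j) - 1) -
      (MonoidAlgebra.of ℤ H (h j) - 1) * (MonoidAlgebra.of ℤ H (h i) - 1) =
      (MonoidAlgebra.of ℤ H c - 1) + (MonoidAlgebra.of ℤ H c - 1) *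
        (MonoidAlgebra.of ℤ H (h j * h i) - 1) := by
    have h3 : (MonoidAlgebra.of ℤ H (h i) - 1) * (MonoidAlgebra.of ℤ H (h j) - 1) -
      (MonoidAlgebra.of ℤ H (h j) - 1) * (MonoidAlgebra.of ℤ H (h i) - 1) =
      MonoidAlgebra.of ℤ H (h i) * MonoidAlgebra.of ℤ H (h j) -
        MonoidAlgebra.of ℤ H (h j) * MonoidAlgebra.of ℤ H (h i) := by noncomm_ring
    rw [h3, h1, map_mul (MonoidAlgebra.of ℤ H) (h j)]
    clear_value c
    noncomm_ring
  have hε : ((ε : ℝ) : WithTop ℝ) ≤ ω.val (h j * h i) :=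
    (WithTop.coe_le_coe.2 F.le_inv).trans (ω.lt_val _).le
  rw [h2]
  exact add_mem (F.of_sub_one_mem_wordSup hcv) (AddSubgroup.mem_sup_right
    (mul_mem_augFiltration (of_sub_one_mem_augFiltration hcv) (of_sub_one_mem_augFiltration hε)))

/-- Permuting the letters of a word costs shorter words of the same weight, up to a gain of `ε`. -/
theorem perm_sub_mem_wordSup [Fact p.Prime] {l l' : List (Fin d)} (hl : l.Perm l') :
    (l.map fun i => MonoidAlgebra.of ℤ H (h i) - 1).prod -
      (l'.map fun i => MonoidAlgebra.of ℤ H (h i) - 1).prod ∈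
      ω.wordSup h w ε l.length (l.map w).sum := by
  induction hl with
  | nil => simp
  | cons i _ ih =>
    rename_i l l' _
    simp only [List.map_cons, List.prod_cons, List.sum_cons, List.length_cons]
    rw [← mul_sub, add_comm l.length 1]
    exact F.mul_mem_wordSup (letter_mem_wordSup i) ih
  | swap i j l =>
    simp only [List.map_cons, List.prod_cons, List.sum_cons, List.length_cons]
    rw [← mul_assoc, ← mul_assoc, ← sub_mul, ← add_assoc,
      show l.length + 1 + 1 = 1 + (l.length + 1) by omega]
    exact F.mul_mem_wordSup (F.swap_sub_mem_wordSup j i) (word_mem_wordSup l)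
  | trans h1 _ ih1 ih2 =>
    rw [← h1.length_eq, ← (h1.map w).sum_eq] at ih2
    have := add_mem ih1 ih2
    rwa [sub_add_sub_cancel] at this

/-- Sorting words, by induction on the length, leaves ordered monomials up to a gain of `ε`. -/
theorem wordSup_le_monomialSpan [Fact p.Prime] (n : ℕ) (ν : ℝ) :
    ω.wordSup h w ε n ν ≤ monomialSpan p h w ν ⊔ ω.augFiltration (ν + ε) := by
  refine sup_le ?_ le_sup_right
  induction n with
  | zero =>
    refine (AddSubgroup.closure_le _).2 ?_
    rintro _ ⟨m, l, h1, -⟩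
    exact absurd h1 (Nat.not_lt_zero _)
  | succ n ih =>
    refine (AddSubgroup.closure_le _).2 ?_
    rintro _ ⟨m, l, h1, h2, rfl⟩
    -- the letters of `l` in increasing order
    set l' := (List.ofFn fun i => List.replicate (l.count i) i).flatten with hl'
    have hperm : l.Perm l' := by
      rw [List.perm_iff_count]
      intro i
      rw [hl', List.count_flatten, List.map_ofFn, List.sum_ofFn]
      simp only [Function.comp_apply, List.count_replicate]
      simp
    have h3 := F.mul_mem_wordSup (prime_pow_mem_wordSup m) (F.perm_sub_mem_wordSup hperm)
    rw [zero_add] at h3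
    have h4 := wordSup_mono (Nat.lt_succ_iff.1 h1) h2 h3
    have h5 := (sup_le ih le_sup_right : ω.wordSup h w ε n ν ≤ _) h4
    have h6 : (p : MonoidAlgebra ℤ H) ^ m *
        (l'.map fun i => MonoidAlgebra.of ℤ H (h i) - 1).prod ∈
        monomialSpan p h w ν ⊔ ω.augFiltration (ν + ε) := by
      refine AddSubgroup.mem_sup_left (AddSubgroup.subset_closure ⟨m, fun i => l.count i, ?_, ?_⟩)
      · refine h2.trans_eq ?_
        rw [(hperm.map w).sum_eq, hl', List.map_flatten, List.sum_flatten, List.map_ofFn,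
          List.map_ofFn, List.sum_ofFn]
        simp
      · rw [hl', List.map_flatten, List.prod_flatten, List.map_ofFn, List.map_ofFn]
        simp [Function.comp_def]
    have h7 := add_mem h5 h6
    rwa [mul_sub, sub_add_cancel] at h7

theorem augFiltration_le [Fact p.Prime] (ν : ℝ) :
    ω.augFiltration ν ≤ monomialSpan p h w ν ⊔ ω.augFiltration (ν + ε) := fun u hu => by
  obtain ⟨n, hn⟩ := F.exists_mem_wordSup hu
  exact F.wordSup_le_monomialSpan n ν hn

/-- Modulo elements of arbitrarily large weight, every element is a combination of ordered
monomials of at least the same weight. -/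
theorem augFiltration_le_monomialSpan [Fact p.Prime] (ν μ : ℝ) :
    ω.augFiltration ν ≤ monomialSpan p h w ν ⊔ ω.augFiltration μ := by
  have key : ∀ n : ℕ, ω.augFiltration ν ≤ monomialSpan p h w ν ⊔ ω.augFiltration (ν + n * ε) := by
    intro n
    induction n with
    | zero => simp
    | succ n ih =>
      refine ih.trans (sup_le le_sup_left ((F.augFiltration_le _).trans
        (sup_le_sup (AddSubgroup.closure_mono ?_) (augFiltration_antitone ?_))))
      · rintro _ ⟨m, γ, h1, h2⟩
        exact ⟨m, γ, le_trans (by nlinarith [F.pos, (Nat.cast_nonneg n : (0 : ℝ) ≤ n)]) h1, h2⟩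
      · push_cast; linarith
  obtain ⟨n, hn⟩ := exists_nat_ge ((μ - ν) / ε)
  refine (key n).trans (sup_le_sup_left (augFiltration_antitone ?_) _)
  rw [div_le_iff₀ F.pos] at hn
  linarith

end IsFrame

end PValuation

end Straightening

/-! ### Linear extension to the group ring -/

section LinearExtension

variable {H A : Type*} [Group H]

/-- The `R`-linear extension of a function on `H` to the group ring. -/
def linExt (R : Type*) [CommRing R] [AddCommGroup A] [Module R A] (f : H → A) :
    MonoidAlgebra R H →ₗ[R] A :=
  (Finsupp.linearCombination R f).comp (MonoidAlgebra.coeffLinearEquiv R).toLinearMap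

theorem linExt_of {R : Type*} [CommRing R] [AddCommGroup A] [Module R A] (f : H → A) (g : H) :
    linExt R f (MonoidAlgebra.of R H g) = f g := by
  simp [linExt, MonoidAlgebra.coeffLinearEquiv]

theorem linExt_natCast_mul [Ring A] (f : H → A) (n : ℕ) (u : MonoidAlgebra ℤ H) :
    linExt ℤ f ((n : MonoidAlgebra ℤ H) * u) = n * linExt ℤ f u := by
  rw [← nsmul_eq_mul, map_nsmul, nsmul_eq_mul]

theorem linExt_prime_pow_mul [Ring A] (f : H → A) (p m : ℕ) (u : MonoidAlgebra ℤ H) :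
    linExt ℤ f ((p : MonoidAlgebra ℤ H) ^ m * u) = (p : A) ^ m * linExt ℤ f u := by
  rw [← Nat.cast_pow, linExt_natCast_mul, Nat.cast_pow]

/-- A family annihilated by all finite Newton expansions vanishes. -/
theorem eq_zero_of_newton_eq_zero {n : ℕ} [Ring A] (e : (Fin n → ℕ) → A)
    (he : ∀ (a : Fin n → ℕ) (N : ℕ), (∀ i, a i ≤ N) → ∑ α : Fin n → Fin (N + 1),
      ((∏ i, (a i).choose (α i) : ℕ) : A) * e (fun i => α i) = 0) (γ : Fin n → ℕ) : e γ = 0 := by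
  induction γ using WellFoundedLT.induction with
  | _ γ ih =>
    have hN : ∀ i, γ i ≤ ∑ j, γ j := fun i => Finset.single_le_sum (fun _ _ => Nat.zero_le _)
      (Finset.mem_univ i)
    have h := he γ _ hN
    -- in the expansion at `a = γ` only `α ≤ γ` contribute, and `α = γ` does so with coefficient `1`
    rw [Finset.sum_eq_single (fun i => ⟨γ i, Nat.lt_succ_of_le (hN i)⟩ :
      Fin n → Fin (∑ j, γ j + 1))] at h
    · simpa using h
    · intro α _ hα
      by_cases hle : ∀ i, (α i : ℕ) ≤ γ i
      · rw [ih (fun i => α i) (lt_of_le_of_ne hle fun h => hα (funext fun i => Fin.ext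
          (congrFun h i))), mul_zero]
      · push Not at hle
        obtain ⟨i, hi⟩ := hle
        rw [Finset.prod_eq_zero (Finset.mem_univ i) (Nat.choose_eq_zero_of_lt hi), Nat.cast_zero,
          zero_mul]
    · exact fun h => absurd (Finset.mem_univ _) h

end LinearExtension

/-! ### Continuous functions on a `p`-valued group -/

section Continuity

variable {p : ℕ} {H : Type*} [Group H]

namespace PValuation

/-- The subgroup `{g | ν ≤ ω g}`. -/
def ball (ω : PValuation p H) (ν : ℝ) : Subgroup H where
  carrier := {g | (ν : WithTop ℝ) ≤ ω.val g}
  one_mem' := by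
    rw [Set.mem_ofPred_eq, (ω.val_eq_top_iff 1).2 rfl]
    exact le_top
  inv_mem' {g} hg := by
    have h := ω.min_le_val g 1
    rw [(ω.val_eq_top_iff 1).2 rfl, mul_one, min_eq_left le_top] at h
    exact le_trans hg h
  mul_mem' {g h} hg hh := by
    have h1 := ω.min_le_val g 1
    rw [(ω.val_eq_top_iff 1).2 rfl, mul_one, min_eq_left le_top] at h1
    have h2 := ω.min_le_val g⁻¹ h
    rw [inv_inv] at h2
    exact (le_min (le_trans hg h1) hh).trans h2

variable {ω : PValuation p H}

theorem mem_ball {ν : ℝ} {g : H} : g ∈ ω.ball ν ↔ (ν : WithTop ℝ) ≤ ω.val g := Iff.rfl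

theorem val_pos [hp : Fact p.Prime] (ω : PValuation p H) (g : H) :
    ((0 : ℝ) : WithTop ℝ) < ω.val g := by
  have hp1 : (1 : ℝ) < p := by exact_mod_cast hp.out.one_lt
  refine lt_of_le_of_lt (WithTop.coe_le_coe.2 ?_) (ω.lt_val g)
  exact one_div_nonneg.2 (by linarith)

instance ball_normal [Fact p.Prime] (ν : ℝ) : (ω.ball ν).Normal where
  conj_mem h hh g := by
    have h1 : g * h * g⁻¹ * h⁻¹ ∈ ω.ball ν := by
      refine le_trans ?_ (ω.add_le_val_commutator g h)
      refine le_trans hh ?_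
      exact le_add_of_nonneg_left (ω.val_pos g).le
    simpa using mul_mem h1 hh

theorem val_pow_prime_pow (g : H) (k : ℕ) :
    ω.val (g ^ p ^ k) = ω.val g + ((k : ℝ) : WithTop ℝ) := by
  induction k with
  | zero => simp
  | succ k ih =>
    rw [pow_succ, pow_mul, ω.val_pow, ih, add_assoc]
    congr 1
    rw [Nat.cast_succ, WithTop.coe_add]
    rfl

theorem pow_prime_pow_mem_ball [Fact p.Prime] (g : H) {k : ℕ} {ν : ℝ} (h : ν ≤ k) :
    g ^ p ^ k ∈ ω.ball ν := by
  rw [mem_ball, val_pow_prime_pow]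
  exact (WithTop.coe_le_coe.2 h).trans (le_add_of_nonneg_left (ω.val_pos g).le)

variable [TopologicalSpace H]

theorem DefinesTopology.ball_mem_nhds (hω : ω.DefinesTopology) (ν : ℝ) :
    (ω.ball ν : Set H) ∈ 𝓝 (1 : H) :=
  HasBasis.mem_of_mem hω (i := ν) trivial

theorem DefinesTopology.isOpen_ball [IsTopologicalGroup H] (hω : ω.DefinesTopology) (ν : ℝ) :
    IsOpen (ω.ball ν : Set H) :=
  Subgroup.isOpen_of_mem_nhds _ (hω.ball_mem_nhds ν)

theorem DefinesTopology.tendsto_iff [IsTopologicalGroup H] (hω : ω.DefinesTopology)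
    {ι : Type*} {l : Filter ι} {f : ι → H}
    {g : H} : Tendsto f l (𝓝 g) ↔ ∀ ν : ℝ, ∀ᶠ i in l, (f i)⁻¹ * g ∈ ω.ball ν := by
  have h1 : Tendsto f l (𝓝 g) ↔ Tendsto (fun i => (f i)⁻¹ * g) l (𝓝 1) := by
    constructor
    · intro h
      simpa using h.inv.mul_const g
    · intro h
      simpa using (h.inv.const_mul g)
  rw [h1, HasBasis.tendsto_right_iff hω]
  simp only [true_imp_iff]
  rfl

/-- A continuous function on a compact group is uniformly continuous. -/
theorem DefinesTopology.exists_dvd_sub [hp : Fact p.Prime] [IsTopologicalGroup H]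
    [CompactSpace H] (hω : ω.DefinesTopology) {f : H → ℤ_[p]}
    (hf : Continuous f) (M : ℕ) :
    ∃ ν : ℝ, ∀ x u, u ∈ ω.ball ν → (p : ℤ_[p]) ^ M ∣ f (x * u) - f x := by
  have hp0 : (0 : ℝ) < (p : ℝ) ^ (-(M : ℤ)) := zpow_pos (by exact_mod_cast hp.out.pos) _
  have hc : Continuous fun q : H × H => ‖f (q.1 * q.2) - f q.1‖ := by fun_prop
  obtain ⟨U, V, -, hV, hU, h1V, hUV⟩ := generalized_tube_lemma (isCompact_univ (X := H))
    (isCompact_singleton (x := (1 : H)))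
    (isOpen_lt hc (continuous_const (y := (p : ℝ) ^ (-(M : ℤ)))))
    (by rintro ⟨x, u⟩ ⟨-, hu⟩
        simp only [Set.mem_singleton_iff] at hu
        simpa [hu] using hp0)
  obtain ⟨ν, -, hν⟩ := HasBasis.mem_iff hω |>.1 (hV.mem_nhds (h1V rfl))
  refine ⟨ν, fun x u hu => ?_⟩
  have h := hUV (Set.mk_mem_prod (hU (Set.mem_univ x)) (hν hu))
  exact Ideal.mem_span_singleton.1 ((PadicInt.norm_le_pow_iff_mem_span_pow _ _).1 (le_of_lt h))

/-- Elements of large weight are annihilated, modulo `p ^ M`, by every continuous function: the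
function is defined modulo `p ^ M` on a finite `p`-group quotient, whose augmentation ideal
is nilpotent. -/
theorem DefinesTopology.exists_dvd_linExt [hp : Fact p.Prime] [IsTopologicalGroup H]
    [CompactSpace H] (hω : ω.DefinesTopology) {f : H → ℤ_[p]}
    (hf : Continuous f) (M : ℕ) :
    ∃ N : ℝ, ∀ u ∈ ω.augFiltration N, (p : ℤ_[p]) ^ M ∣ linExt ℤ f u := by
  obtain ⟨ν, hν⟩ := hω.exists_dvd_sub hf M
  let Q := H ⧸ ω.ball ν
  have hQfin : Finite Q := Subgroup.quotient_finite_of_isOpen _ (hω.isOpen_ball ν)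
  have hQ : IsPGroup p Q := by
    intro q
    obtain ⟨g, rfl⟩ := QuotientGroup.mk_surjective q
    obtain ⟨k, hk⟩ := exists_nat_ge ν
    exact ⟨k, (QuotientGroup.eq_one_iff _).2 (pow_prime_pow_mem_ball g hk)⟩
  have : NeZero (p ^ M) := ⟨pow_ne_zero _ hp.out.ne_zero⟩
  let R := MonoidAlgebra (ZMod (p ^ M)) Q
  have hRfin : Finite R := Finite.of_equiv (Q → ZMod (p ^ M))
    (Finsupp.equivFunOnFinite.symm.trans MonoidAlgebra.coeffEquiv.symm)
  have hcast : ((p ^ M : ℕ) : R) = 0 := by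
    rw [← map_natCast (algebraMap (ZMod (p ^ M)) R), ZMod.natCast_self, map_zero]
  have hR : IsPGroup p (Multiplicative R) := fun x => ⟨M, by
    apply Multiplicative.toAdd.injective
    rw [toAdd_pow, toAdd_one, nsmul_eq_mul, hcast, zero_mul]⟩
  obtain ⟨n, hn⟩ := exists_prod_map_sub_one_eq_zero hR hQ (MonoidAlgebra.of (ZMod (p ^ M)) Q)
  let π : MonoidAlgebra ℤ H →ₐ[ℤ] R :=
    MonoidAlgebra.lift ℤ R H ((MonoidAlgebra.of (ZMod (p ^ M)) Q).comp (QuotientGroup.mk' _))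
  have hπ : ∀ g, π (MonoidAlgebra.of ℤ H g) = MonoidAlgebra.of (ZMod (p ^ M)) Q (g : Q) :=
    fun g => MonoidAlgebra.lift_of _ _
  have hdvd : ∀ x : ℤ_[p], (p : ℤ_[p]) ^ M ∣ x ↔ PadicInt.toZModPow M x = 0 := fun x => by
    rw [← RingHom.mem_ker, PadicInt.ker_toZModPow, Ideal.mem_span_singleton]
  let fbar : Q → ZMod (p ^ M) := Quotient.lift (fun x => PadicInt.toZModPow M (f x)) (by
    intro x y hxy
    have h1 : x⁻¹ * y ∈ ω.ball ν := QuotientGroup.leftRel_apply.1 hxy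
    have h2 := hν x _ h1
    rw [mul_inv_cancel_left, hdvd, map_sub, sub_eq_zero] at h2
    exact h2.symm)
  have hcomp : ∀ u, PadicInt.toZModPow M (linExt ℤ f u) = linExt (ZMod (p ^ M)) fbar (π u) := by
    intro u
    induction u using MonoidAlgebra.induction_on with
    | of g => rw [linExt_of, hπ, linExt_of]; rfl
    | add u v hu hv => rw [map_add, map_add, map_add, map_add, hu, hv]
    | smul r u hu => rw [map_zsmul, map_zsmul, map_zsmul, map_zsmul, hu]
  -- a product of weight at least `M + n * max ν 1` has a factor `p ^ M`, or a factor `g - 1`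
  -- with `g` in the kernel, or at least `n` factors
  refine ⟨M + n * max ν 1, fun u hu => ?_⟩
  induction hu using AddSubgroup.closure_induction with
  | zero => simp
  | add x y _ _ hx hy => rw [map_add]; exact dvd_add hx hy
  | neg x _ hx => rw [map_neg]; exact (dvd_neg (α := ℤ_[p])).2 hx
  | mem x hx =>
    obtain ⟨m, l, h1, h2, rfl⟩ := hx
    rw [linExt_prime_pow_mul]
    rcases le_or_gt M m with hm | hm
    · exact (pow_dvd_pow _ hm).mul_right _
    refine Dvd.dvd.mul_left ?_ _
    rw [hdvd, hcomp, map_list_prod, List.map_map]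
    have hmap : (π ∘ fun q : H × ℝ => MonoidAlgebra.of ℤ H q.1 - 1) =
        (fun q : Q => MonoidAlgebra.of (ZMod (p ^ M)) Q q - 1) ∘ fun q : H × ℝ => (q.1 : Q) := by
      funext q
      simp only [Function.comp_apply]
      rw [map_sub, map_one, hπ]
    rw [hmap, ← List.map_map]
    by_cases hex : ∃ q ∈ l, q.1 ∈ ω.ball ν
    · obtain ⟨q, hq, hqν⟩ := hex
      rw [List.prod_eq_zero, map_zero]
      refine List.mem_map.2 ⟨(q.1 : Q), List.mem_map.2 ⟨q, hq, rfl⟩, ?_⟩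
      rw [(QuotientGroup.eq_one_iff _).2 hqν, map_one, sub_self]
    · push Not at hex
      rw [hn, map_zero]
      rw [List.length_map]
      have h3 : (l.map Prod.snd).sum ≤ l.length * max ν 1 := by
        have := List.sum_le_card_nsmul (l.map Prod.snd) (max ν 1) (by
          intro x hx
          obtain ⟨q, hq, rfl⟩ := List.mem_map.1 hx
          have h4 := (h1 q hq).trans_lt (not_le.1 (hex q hq))
          exact (WithTop.coe_lt_coe.1 h4).le.trans (le_max_left _ _))
        simpa using this
      have h4 : (m : ℝ) < M := by exact_mod_cast hm
      have h5 : (n : ℝ) * max ν 1 ≤ l.length * max ν 1 := by linarith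
      exact_mod_cast le_of_mul_le_mul_right h5 (lt_of_lt_of_le one_pos (le_max_right _ _))

end PValuation

end Continuity

/-! ### Ordered products with natural exponents -/

section OrderedBasisBasics

variable {p : ℕ} [hp : Fact p.Prime] {H : Type*} [Group H] [TopologicalSpace H]

/-- The power `h ^ x` with `p`-adic exponent, defined as a limit over integers tending to `x`, is
the usual one for `x ∈ ℕ`. -/
theorem padicPow_natCast [IsTopologicalGroup H] [T2Space H] {ω : PValuation p H}
    (hω : ω.DefinesTopology) (h : H) (a : ℕ) : padicPow h (a : ℤ_[p]) = h ^ a := by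
  have hne : (comap (Int.cast : ℤ → ℤ_[p]) (𝓝 (a : ℤ_[p]))).NeBot := by
    rw [comap_neBot_iff]
    intro t ht
    obtain ⟨_, h1, n, rfl⟩ := mem_closure_iff_nhds.1 (PadicInt.denseRange_intCast (a : ℤ_[p])) t ht
    exact ⟨n, h1⟩
  refine Tendsto.limUnder_eq (hω.tendsto_iff.2 fun ν => ?_)
  obtain ⟨k, hk⟩ := exists_nat_ge ν
  have hpos : (0 : ℝ) < (p : ℝ) ^ (-(k : ℤ)) := zpow_pos (by exact_mod_cast hp.out.pos) _
  have hball := preimage_mem_comap (m := (Int.cast : ℤ → ℤ_[p]))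
    (Metric.ball_mem_nhds (a : ℤ_[p]) hpos)
  filter_upwards [hball] with n hn
  rw [Set.mem_preimage, Metric.mem_ball, dist_eq_norm] at hn
  have hn' : ‖((n - a : ℤ) : ℤ_[p])‖ ≤ (p : ℝ) ^ (-(k : ℤ)) := by
    push_cast
    exact hn.le
  obtain ⟨c, hc⟩ := PadicInt.norm_int_le_pow_iff_dvd.1 hn'
  have h1 : (h ^ n)⁻¹ * h ^ a = ((h ^ p ^ k) ^ c)⁻¹ := by
    rw [← zpow_natCast h (p ^ k), ← zpow_mul, Nat.cast_pow, ← hc, ← zpow_natCast h a, ← zpow_neg,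
      ← zpow_neg, ← zpow_add]
    congr 1
    ring
  rw [h1]
  exact inv_mem (zpow_mem (PValuation.pow_prime_pow_mem_ball h hk) c)

/-- The natural tuples are dense in `ℤ_p ^ n`. -/
theorem denseRange_natCast_pi (p : ℕ) [Fact p.Prime] (n : ℕ) :
    DenseRange fun (a : Fin n → ℕ) (i : Fin n) => (a i : ℤ_[p]) :=
  DenseRange.piMap (f := fun _ => ((↑) : ℕ → ℤ_[p])) fun _ => PadicInt.denseRange_natCast

theorem prod_ofFn_pow_single {M : Type*} [Monoid M] {n : ℕ} (e : Fin n → M) (k : Fin n) :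
    (List.ofFn fun i => e i ^ (Pi.single k 1 : Fin n → ℕ) i).prod = e k := by
  induction n with
  | zero => exact k.elim0
  | succ n ih =>
    rw [List.ofFn_succ, List.prod_cons]
    induction k using Fin.cases with
    | zero =>
      have h0 : (List.ofFn fun i : Fin n => e i.succ ^ (Pi.single 0 1 : Fin (n + 1) → ℕ) i.succ) =
          List.ofFn fun _ : Fin n => (1 : M) := by
        congr 1
        funext i
        rw [Pi.single_eq_of_ne (Fin.succ_ne_zero i), pow_zero]
      rw [h0]
      simp [List.ofFn_const]
    | succ k =>
      rw [Pi.single_eq_of_ne (Fin.succ_ne_zero k).symm, pow_zero, one_mul]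
      have h0 : ∀ i : Fin n, (Pi.single k.succ 1 : Fin (n + 1) → ℕ) i.succ =
          (Pi.single k 1 : Fin n → ℕ) i := by
        intro i
        by_cases hi : i = k
        · subst hi; simp
        · rw [Pi.single_eq_of_ne hi, Pi.single_eq_of_ne (fun h => hi (Fin.succ_injective _ h))]
      simp only [h0]
      exact ih (fun i => e i.succ) k

namespace OrderedBasis

variable {ω : PValuation p H} {d : ℕ} (b : OrderedBasis ω d)

include b in
theorem t2Space : T2Space H := b.isHomeomorph.homeomorph.t2Space

include b in
theorem compactSpace : CompactSpace H := b.isHomeomorph.homeomorph.compactSpace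

theorem orderedProd_coord (g : H) : orderedProd b.elt (b.coord g) = g :=
  (Equiv.ofBijective _ b.isHomeomorph.bijective).apply_symm_apply g

theorem coord_orderedProd (x : Fin d → ℤ_[p]) : b.coord (orderedProd b.elt x) = x :=
  (Equiv.ofBijective _ b.isHomeomorph.bijective).symm_apply_apply x

theorem continuous_orderedProd : Continuous (orderedProd b.elt : (Fin d → ℤ_[p]) → H) :=
  b.isHomeomorph.continuous

theorem continuous_coord : Continuous b.coord :=
  b.isHomeomorph.homeomorph.symm.continuous

theorem orderedProd_natCast [IsTopologicalGroup H] (hω : ω.DefinesTopology) (a : Fin d → ℕ) :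
    orderedProd b.elt (fun i => (a i : ℤ_[p])) = (List.ofFn fun i => b.elt i ^ a i).prod := by
  have := b.t2Space
  simp only [orderedProd, padicPow_natCast hω]

theorem coord_prod_pow [IsTopologicalGroup H] (hω : ω.DefinesTopology) (a : Fin d → ℕ) (k : Fin d) :
    b.coord (List.ofFn fun i => b.elt i ^ a i).prod k = a k := by
  rw [← b.orderedProd_natCast hω, coord_orderedProd]

theorem coord_one [IsTopologicalGroup H] (hω : ω.DefinesTopology) (k : Fin d) :
    b.coord 1 k = 0 := by
  have := b.coord_prod_pow hω (fun _ => 0) k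
  simpa [List.ofFn_const] using this

theorem coord_elt [IsTopologicalGroup H] (hω : ω.DefinesTopology) (k : Fin d) :
    b.coord (b.elt k) k = 1 := by
  have h1 := b.coord_prod_pow hω (Pi.single k 1) k
  rwa [Pi.single_eq_same, Nat.cast_one, prod_ofFn_pow_single] at h1

end OrderedBasis

end OrderedBasisBasics

/-! ### Coordinates of elements of the group ring -/

section CoordinateBound

variable {p : ℕ} [hp : Fact p.Prime] {H : Type*} [Group H] [TopologicalSpace H]
  {ω : PValuation p H} {d : ℕ} (b : OrderedBasis ω d)

theorem exists_pow_dvd_of_le_padicIntVal {a : ℕ} {r w : ℝ}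
    (h : (r : WithTop ℝ) ≤ padicIntVal (a : ℤ_[p]) + w) : ∃ k : ℕ, p ^ k ∣ a ∧ r ≤ k + w := by
  rcases eq_or_ne a 0 with rfl | ha
  · obtain ⟨k, hk⟩ := exists_nat_ge (r - w)
    exact ⟨k, dvd_zero _, by linarith⟩
  · have ha' : (a : ℤ_[p]) ≠ 0 := by exact_mod_cast ha
    refine ⟨(a : ℤ_[p]).valuation, ?_, ?_⟩
    · have h1 := (PadicInt.mem_span_pow_iff_le_valuation (a : ℤ_[p]) ha' _).2 le_rfl
      rw [Ideal.mem_span_singleton] at h1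
      have h2 := (PadicInt.pow_p_dvd_int_iff (p := p) (a : ℤ_[p]).valuation (a : ℤ)).1
        (by exact_mod_cast h1)
      exact_mod_cast h2
    · rw [padicIntVal, if_neg ha', ← WithTop.coe_add, WithTop.coe_le_coe] at h
      exact h

namespace OrderedBasis

theorem elt_ne_one [IsTopologicalGroup H] (hω : ω.DefinesTopology) (k : Fin d) : b.elt k ≠ 1 := by
  intro h
  have h1 := b.coord_elt hω k
  rw [h, b.coord_one hω] at h1
  exact zero_ne_one h1

/-- The value of `ω` on the `k`-th member of the basis, as a real number; the default `0` is never
taken, see `val_elt`. -/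
def weight (k : Fin d) : ℝ := (ω.val (b.elt k)).untopD 0

variable [IsTopologicalGroup H] (hω : ω.DefinesTopology)
include hω

theorem val_elt (k : Fin d) : ω.val (b.elt k) = b.weight k := by
  have h : ω.val (b.elt k) ≠ ⊤ := fun h => b.elt_ne_one hω k ((ω.val_eq_top_iff _).1 h)
  obtain ⟨r, hr⟩ := WithTop.ne_top_iff_exists.1 h
  rw [weight, ← hr, WithTop.untopD_coe]

/-- An ordered basis is a frame: the approximation of `g` is the ordered product whose exponents are
natural numbers close to the coordinates of `g`. -/
theorem exists_isFrame : ∃ ε, ω.IsFrame b.elt b.weight ε := by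
  have hp1 : (0 : ℝ) < (p : ℝ) - 1 := by
    have : (1 : ℝ) < p := by exact_mod_cast hp.out.one_lt
    linarith
  have hw : ∀ i, 0 < b.weight i - 1 / ((p : ℝ) - 1) := fun i => by
    have := ω.lt_val (b.elt i)
    rw [b.val_elt hω, WithTop.coe_lt_coe] at this
    linarith
  obtain ⟨δ, hδ0, hδ⟩ : ∃ δ > 0, ∀ i, δ ≤ b.weight i - 1 / ((p : ℝ) - 1) := by
    rcases isEmpty_or_nonempty (Fin d) with he | hne
    · exact ⟨1, one_pos, fun i => he.elim i⟩
    · obtain ⟨j, hj⟩ := Finite.exists_min fun i => b.weight i - 1 / ((p : ℝ) - 1)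
      exact ⟨_, hw j, hj⟩
  refine ⟨min δ (1 / ((p : ℝ) - 1)), b.val_elt hω, lt_min hδ0 (by positivity), min_le_right _ _,
    fun i => by linarith [hδ i, min_le_left δ (1 / ((p : ℝ) - 1))], fun g r hr => ?_⟩
  set ε := min δ (1 / ((p : ℝ) - 1))
  have hε : 0 < ε := lt_min hδ0 (by positivity)
  have htend : Tendsto (fun x => orderedProd b.elt x) (𝓝 (b.coord g)) (𝓝 g) := by
    have := b.continuous_orderedProd.tendsto (b.coord g)
    rwa [b.orderedProd_coord] at this
  have hev := hω.tendsto_iff.1 htend (r + ε)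
  obtain ⟨_, hx, a, rfl⟩ := mem_closure_iff_nhds.1 (denseRange_natCast_pi p d (b.coord g)) _ hev
  rw [Set.mem_ofPred_eq, b.orderedProd_natCast hω] at hx
  refine ⟨a, fun i => ?_, hx⟩
  set t := (List.ofFn fun i => b.elt i ^ a i).prod with ht
  have htr : t ∈ ω.ball r := by
    have h1 : t⁻¹ * g ∈ ω.ball r :=
      le_trans (WithTop.coe_le_coe.2 (by linarith)) (PValuation.mem_ball.1 hx)
    have h2 : g * (t⁻¹ * g)⁻¹ = t := by group
    rw [← h2]
    exact mul_mem (PValuation.mem_ball.2 hr) (inv_mem h1)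
  have h3 := PValuation.mem_ball.1 htr
  rw [ht, ← b.orderedProd_natCast hω, b.val_orderedProd] at h3
  have h4 := (Finset.le_inf_iff.1 h3) i (Finset.mem_univ i)
  rw [b.val_elt hω] at h4
  exact exists_pow_dvd_of_le_padicIntVal h4

/-- The `k`-th coordinate detects the ordered monomial `h_k - 1`. -/
theorem linExt_coord_monomial (k : Fin d) (γ : Fin d → ℕ) :
    linExt ℤ (fun g => b.coord g k)
      (List.ofFn fun i => (MonoidAlgebra.of ℤ H (b.elt i) - 1) ^ γ i).prod =
        if γ = Pi.single k 1 then 1 else 0 := by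
  -- both sides have the Newton sum `a k` at the exponents `a`
  rw [← sub_eq_zero]
  refine eq_zero_of_newton_eq_zero (fun γ => linExt ℤ (fun g => b.coord g k)
      (List.ofFn fun i => (MonoidAlgebra.of ℤ H (b.elt i) - 1) ^ γ i).prod -
        if γ = Pi.single k 1 then 1 else 0) (fun a N haN => ?_) γ
  have h1 := congrArg (linExt ℤ fun g => b.coord g k)
    (prod_ofFn_pow_eq_sum (fun i => MonoidAlgebra.of ℤ H (b.elt i)) a haN)
  have h2 : (List.ofFn fun i => MonoidAlgebra.of ℤ H (b.elt i) ^ a i).prod =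
      MonoidAlgebra.of ℤ H (List.ofFn fun i => b.elt i ^ a i).prod := by
    rw [map_list_prod, List.map_ofFn]
    simp only [Function.comp_def, map_pow]
  rw [h2, linExt_of, b.coord_prod_pow hω, map_sum] at h1
  simp only [linExt_natCast_mul] at h1
  simp only [mul_sub, Finset.sum_sub_distrib]
  rw [← h1, sub_eq_zero]
  rcases Nat.eq_zero_or_pos N with rfl | hN
  · have hak : a k = 0 := Nat.le_zero.1 (haN k)
    rw [hak, Nat.cast_zero, Finset.sum_eq_zero]
    intro α _
    rw [if_neg, mul_zero]
    intro h
    have := congrFun h k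
    simp at this
  · rw [Finset.sum_eq_single (Pi.single k ⟨1, Nat.lt_succ_of_le hN⟩ : Fin d → Fin (N + 1))]
    · have h3 : (fun i => (((Pi.single k ⟨1, Nat.lt_succ_of_le hN⟩ : Fin d → Fin (N + 1)) i :
          Fin (N + 1)) : ℕ)) = Pi.single k 1 := by
        funext i
        by_cases hi : i = k
        · subst hi; simp
        · simp [Pi.single_eq_of_ne hi]
      rw [if_pos h3, mul_one]
      congr 1
      rw [Finset.prod_eq_single k]
      · simp
      · intro i _ hi
        simp [Pi.single_eq_of_ne hi]
      · exact fun h => absurd (Finset.mem_univ _) h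
    · intro α _ hα
      rw [if_neg, mul_zero]
      intro h
      refine hα (funext fun i => Fin.ext ?_)
      rw [congrFun h i]
      by_cases hi : i = k
      · subst hi; simp
      · simp [Pi.single_eq_of_ne hi]
    · exact fun h => absurd (Finset.mem_univ _) h

/-- The `k`-th coordinate maps elements of weight at least `ν` to `p`-adic integers of valuation at
least `ν - ω h_k`. -/
theorem pow_dvd_linExt_coord (k : Fin d) {ν : ℝ} {u : MonoidAlgebra ℤ H}
    (hu : u ∈ ω.augFiltration ν) {n : ℕ} (hn : (n : ℝ) < ν - b.weight k + 1) :
    (p : ℤ_[p]) ^ n ∣ linExt ℤ (fun g => b.coord g k) u := by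
  have := b.compactSpace
  obtain ⟨ε, F⟩ := b.exists_isFrame hω
  obtain ⟨N, hN⟩ := hω.exists_dvd_linExt ((continuous_apply k).comp b.continuous_coord) n
  obtain ⟨v, hv, v', hv', rfl⟩ := AddSubgroup.mem_sup.1 (F.augFiltration_le_monomialSpan ν N hu)
  rw [map_add]
  refine dvd_add ?_ (hN v' hv')
  clear hu
  induction hv using AddSubgroup.closure_induction with
  | zero => simp
  | add x y _ _ hx hy => rw [map_add]; exact dvd_add hx hy
  | neg x _ hx => rw [map_neg]; exact (dvd_neg (α := ℤ_[p])).2 hx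
  | mem x hx =>
    obtain ⟨m, γ, h1, rfl⟩ := hx
    rw [linExt_prime_pow_mul, b.linExt_coord_monomial hω]
    split_ifs with hγ
    · refine (pow_dvd_pow _ ?_).mul_right _
      rw [Finset.sum_eq_single k (fun i _ hi => by rw [hγ, Pi.single_eq_of_ne hi]; simp)
        (fun h => absurd (Finset.mem_univ _) h), hγ, Pi.single_eq_same, Nat.cast_one, one_mul] at h1
      have h2 : (n : ℝ) < m + 1 := by linarith
      have h3 : n < m + 1 := by exact_mod_cast h2
      omega
    · rw [mul_zero]; exact dvd_zero _

/-- In a saturated group the members of an ordered basis have value at most `p / (p - 1)`: if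
`h_k = g ^ p`, the `k`-th coordinate of `h_k - 1 = ∑ binom(p, n) (g - 1) ^ n` would be divisible
by `p`. -/
theorem weight_le (hsat : ω.IsSaturated) (k : Fin d) : b.weight k ≤ (p : ℝ) / ((p : ℝ) - 1) := by
  by_contra! hlt
  have hp1 : (0 : ℝ) < (p : ℝ) - 1 := by
    have : (1 : ℝ) < p := by exact_mod_cast hp.out.one_lt
    linarith
  obtain ⟨g, hg⟩ := hsat (b.elt k) (by rw [b.val_elt hω]; exact WithTop.coe_lt_coe.2 hlt)
  have hgv : ((b.weight k - 1 : ℝ) : WithTop ℝ) ≤ ω.val g := by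
    have h1 := ω.val_pow g
    rw [hg, b.val_elt hω] at h1
    have h2 : ω.val g ≠ ⊤ := by
      intro h
      rw [h, top_add] at h1
      exact WithTop.coe_ne_top h1
    obtain ⟨r, hr⟩ := WithTop.ne_top_iff_exists.1 h2
    rw [← hr] at h1 ⊢
    have h3 : b.weight k = r + 1 := by exact_mod_cast h1
    rw [h3, add_sub_cancel_right]
  have key : (p : ℤ_[p]) ∣
      linExt ℤ (fun g => b.coord g k) (MonoidAlgebra.of ℤ H (b.elt k) - 1) := by
    rw [← hg, map_pow, pow_eq_sum_choose (MonoidAlgebra.of ℤ H g) le_rfl, Fin.sum_univ_succ]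
    simp only [Fin.val_zero, Nat.choose_zero_right, Nat.cast_one, pow_zero, mul_one, Fin.val_succ,
      add_sub_cancel_left]
    rw [map_sum]
    refine Finset.dvd_sum fun n _ => ?_
    rw [linExt_natCast_mul]
    rcases eq_or_ne ((n : ℕ) + 1) p with hnp | hnp
    · refine Dvd.dvd.mul_left ?_ _
      -- `(g - 1) ^ p` has weight `p (ω h_k - 1)`, which exceeds `ω h_k`
      have h4 := b.pow_dvd_linExt_coord hω k (n := 1) (PValuation.pow_mem_augFiltration
        (PValuation.of_sub_one_mem_augFiltration hgv) p) (by
          rw [div_lt_iff₀ hp1] at hlt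
          push_cast
          nlinarith)
      rw [pow_one] at h4
      rwa [hnp]
    · refine Dvd.dvd.mul_right ?_ _
      have h5 := hp.out.dvd_choose_self (Nat.succ_ne_zero (n : ℕ)) (by omega)
      exact_mod_cast Nat.cast_dvd_cast (α := ℤ_[p]) h5
  rw [map_sub, linExt_of, ← map_one (MonoidAlgebra.of ℤ H), linExt_of, b.coord_elt hω,
    b.coord_one hω, sub_zero] at key
  exact PadicInt.prime_p.not_isUnit (isUnit_of_dvd_one key)

end OrderedBasis

end CoordinateBound

/-! ### Evaluation of Tate series -/

namespace TateAlgebra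

section Evaluation

variable {K : Type*} [NormedField K] [IsUltrametricDist K] {σ : Type*}
  {B : Type*} [NormedCommRing B] [NormOneClass B] [NormedAlgebra K B]

theorem norm_monomial_le (a : σ → B) (ha : ∀ i, ‖a i‖ ≤ 1) (I : σ →₀ ℕ) :
    ‖I.prod fun i n => a i ^ n‖ ≤ 1 :=
  (Finset.norm_prod_le _ _).trans (Finset.prod_le_one (fun _ _ => norm_nonneg _) fun i _ =>
    (norm_pow_le _ _).trans (pow_le_one₀ (norm_nonneg _) (ha i)))

variable [IsUltrametricDist B]

theorem norm_monomial_sub_le (a a' : σ → B) (ha : ∀ i, ‖a i‖ ≤ 1) (ha' : ∀ i, ‖a' i‖ ≤ 1) {r : ℝ}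
    (hr : 0 ≤ r) (h : ∀ i, ‖a i - a' i‖ ≤ r) (I : σ →₀ ℕ) :
    ‖(I.prod fun i n => a i ^ n) - I.prod fun i n => a' i ^ n‖ ≤ r := by
  have hmul : ∀ x y x' y' : B, ‖x‖ ≤ 1 → ‖y'‖ ≤ 1 → ‖x - x'‖ ≤ r → ‖y - y'‖ ≤ r →
      ‖x * y - x' * y'‖ ≤ r := by
    intro x y x' y' hx hy hxr hyr
    rw [show x * y - x' * y' = x * (y - y') + (x - x') * y' by ring]
    refine (IsUltrametricDist.norm_add_le_max _ _).trans (max_le ?_ ?_)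
    · exact (norm_mul_le _ _).trans ((mul_le_of_le_one_left (norm_nonneg _) hx).trans hyr)
    · exact (norm_mul_le _ _).trans ((mul_le_of_le_one_right (norm_nonneg _) hy).trans hxr)
  induction I using Finsupp.induction_linear with
  | zero => simpa using hr
  | add I J hI hJ =>
    rw [Finsupp.prod_add_index' (fun i => pow_zero _) (fun i m n => pow_add _ _ _),
      Finsupp.prod_add_index' (fun i => pow_zero _) (fun i m n => pow_add _ _ _)]
    exact hmul _ _ _ _ (norm_monomial_le a ha I) (norm_monomial_le a' ha' J) hI hJ
  | single i n =>
    have hsingle : ∀ c : σ → B, ((Finsupp.single i n).prod fun i n => c i ^ n) = c i ^ n :=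
      fun c => Finsupp.prod_single_index (pow_zero _)
    rw [hsingle, hsingle]
    clear hsingle
    induction n with
    | zero => simpa using hr
    | succ n ih =>
      rw [pow_succ, pow_succ]
      exact hmul _ _ _ _ ((norm_pow_le _ _).trans (pow_le_one₀ (norm_nonneg _) (ha i))) (ha' i)
        ih (h i)

variable [CompleteSpace B]

theorem norm_aeval_le (a : σ → B) (ha : ∀ i, ‖a i‖ ≤ 1) (f : TateAlgebra K σ) :
    ‖aeval a ha f‖ ≤ ‖f‖ := by
  rw [aeval_apply]
  refine IsUltrametricDist.norm_tsum_le_of_forall_le_of_nonneg (norm_nonneg f) fun I => ?_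
  exact (norm_smul_le _ _).trans ((mul_le_of_le_one_right (norm_nonneg _)
    (norm_monomial_le a ha I)).trans (norm_coeff_le f I))

theorem continuous_aeval (a : σ → B) (ha : ∀ i, ‖a i‖ ≤ 1) :
    Continuous (aeval a ha : TateAlgebra K σ →ₐ[K] B) :=
  AddMonoidHomClass.continuous_of_bound (aeval a ha) 1 fun f => by
    rw [one_mul]; exact norm_aeval_le a ha f

theorem norm_aeval_sub_le (a a' : σ → B) (ha : ∀ i, ‖a i‖ ≤ 1) (ha' : ∀ i, ‖a' i‖ ≤ 1) {r : ℝ}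
    (hr : 0 ≤ r) (h : ∀ i, ‖a i - a' i‖ ≤ r) (f : TateAlgebra K σ) :
    ‖aeval a ha f - aeval a' ha' f‖ ≤ ‖f‖ * r := by
  rw [aeval_apply, aeval_apply, ← (summable_eval a ha f).tsum_sub (summable_eval a' ha' f)]
  refine IsUltrametricDist.norm_tsum_le_of_forall_le_of_nonneg
    (mul_nonneg (norm_nonneg f) hr) fun I => ?_
  rw [← smul_sub]
  exact (norm_smul_le _ _).trans (mul_le_mul (norm_coeff_le f I)
    (norm_monomial_sub_le a a' ha ha' hr h I) (norm_nonneg _) (norm_nonneg f))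

/-- The value of a Tate series depends continuously on the point. -/
theorem continuous_aeval_apply [Finite σ] {T : Type*} [TopologicalSpace T] (g : T → σ → B)
    (hg : ∀ i, Continuous fun t => g t i) (h : ∀ t i, ‖g t i‖ ≤ 1) (f : TateAlgebra K σ) :
    Continuous fun t => aeval (g t) (h t) f := by
  rw [continuous_iff_continuousAt]
  intro t
  rw [ContinuousAt, Metric.tendsto_nhds]
  intro ε hε
  have hpos : 0 < ε / (‖f‖ + 1) := div_pos hε (by positivity)
  have hev : ∀ᶠ s in 𝓝 t, ∀ i, ‖g s i - g t i‖ ≤ ε / (‖f‖ + 1) := by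
    rw [eventually_all]
    intro i
    filter_upwards [Metric.tendsto_nhds.1 ((hg i).tendsto t) _ hpos] with s hs
    rw [← dist_eq_norm]
    exact hs.le
  filter_upwards [hev] with s hs
  rw [dist_eq_norm]
  refine (norm_aeval_sub_le _ _ _ _ hpos.le hs f).trans_lt ?_
  rw [← mul_div_assoc, div_lt_iff₀ (by positivity)]
  nlinarith [norm_nonneg f]

theorem map_aeval {B' : Type*} [NormedCommRing B'] [NormOneClass B'] [NormedAlgebra K B']
    [CompleteSpace B'] [IsUltrametricDist B'] (a : σ → B) (ha : ∀ i, ‖a i‖ ≤ 1) (ψ : B →ₐ[K] B')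
    (hψ : Continuous ψ) (ha' : ∀ i, ‖ψ (a i)‖ ≤ 1) (f : TateAlgebra K σ) :
    ψ (aeval a ha f) = aeval (fun i => ψ (a i)) ha' f := by
  rw [aeval_apply, aeval_apply, (summable_eval a ha f).map_tsum ψ hψ]
  refine tsum_congr fun I => ?_
  rw [map_smul, map_finsuppProd]
  simp only [map_pow]

theorem continuous_coeff (I : σ →₀ ℕ) : Continuous (coeff I : TateAlgebra K σ → K) :=
  AddMonoidHomClass.continuous_of_bound
    (⟨⟨coeff I, coeff_zero I⟩, coeff_add I⟩ : TateAlgebra K σ →+ K) 1 fun f => by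
    rw [one_mul]; exact norm_coeff_le f I

theorem coeff_monomial_X [DecidableEq σ] (I J : σ →₀ ℕ) :
    coeff I (J.prod fun i n => (X i : TateAlgebra K σ) ^ n) = if I = J then 1 else 0 := by
  have h : (tateSubalgebra K σ).val (J.prod fun i n => (X i : TateAlgebra K σ) ^ n) =
      MvPowerSeries.monomial J 1 := by
    rw [MvPowerSeries.monomial_one_eq]
    exact map_finsuppProd (tateSubalgebra K σ).val _ _
  exact (congrArg (MvPowerSeries.coeff I) h).trans (MvPowerSeries.coeff_monomial _ _ _)

variable [CompleteSpace K]

theorem aeval_X_self (f : TateAlgebra K σ) : aeval (fun i => X i) norm_X_le f = f := by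
  classical
  refine ext fun I => ?_
  have h := (summable_eval (fun i => X i) norm_X_le f).map_tsum
    (⟨⟨coeff I, coeff_zero I⟩, coeff_add I⟩ : TateAlgebra K σ →+ K) (continuous_coeff I)
  refine h.trans ?_
  have h1 : ∀ J : σ →₀ ℕ, coeff I (coeff J f • J.prod fun i n => (X i : TateAlgebra K σ) ^ n) =
      if I = J then coeff J f else 0 := fun J => by
    rw [coeff_smul, coeff_monomial_X, mul_ite, mul_one, mul_zero]
  refine (tsum_congr h1).trans ?_
  rw [tsum_eq_single I fun J hJ => if_neg hJ.symm, if_pos rfl]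

/-- A continuous homomorphism out of a Tate algebra is a substitution. -/
theorem eq_aeval (φ : TateAlgebra K σ →ₐ[K] B) (hφ : Continuous φ) (h : ∀ i, ‖φ (X i)‖ ≤ 1) :
    φ = aeval (fun i => φ (X i)) h := by
  refine AlgHom.ext fun f => ?_
  have := map_aeval (fun i => X i) norm_X_le φ hφ h f
  rwa [aeval_X_self] at this

theorem continuous_point (φ : TateAlgebra K σ →ₐ[K] K) : Continuous φ :=
  AddMonoidHomClass.continuous_of_bound φ 1 fun f => by
    rw [one_mul]; exact AlgHom.norm_apply_le_self φ f

/-- A `K`-rational point is determined by its coordinates. -/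
theorem point_ext {φ ψ : TateAlgebra K σ →ₐ[K] K} (h : ∀ i, φ (X i) = ψ (X i)) : φ = ψ := by
  rw [eq_aeval φ (continuous_point φ) (norm_point_X_le φ),
    eq_aeval ψ (continuous_point ψ) (norm_point_X_le ψ)]
  simp only [h]

end Evaluation

/-! ### The identity principle -/

section Identity

variable {p : ℕ} [hp : Fact p.Prime] {K : Type*} [NormedField K] [NormedAlgebra ℚ_[p] K]
  {σ : Type*}

theorem norm_padicInt_le_one (x : σ → ℤ_[p]) (i : σ) : ‖algebraMap ℚ_[p] K (x i)‖ ≤ 1 := by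
  rw [norm_algebraMap']; exact (x i).2

variable [IsUltrametricDist K] [CompleteSpace K]

/-- The evaluation of a Tate series over `K` at a point of `ℤ_p ^ σ`. -/
def evalInt (K : Type*) [NormedField K] [IsUltrametricDist K]
    [CompleteSpace K] [NormedAlgebra ℚ_[p] K] (x : σ → ℤ_[p]) : TateAlgebra K σ →ₐ[K] K :=
  aeval (fun i => algebraMap ℚ_[p] K (x i)) (norm_padicInt_le_one x)

theorem evalInt_X (x : σ → ℤ_[p]) (i : σ) : evalInt K x (X i) = algebraMap ℚ_[p] K (x i) :=
  aeval_X _ _ _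

theorem continuous_evalInt (x : σ → ℤ_[p]) : Continuous (evalInt K x) := continuous_aeval _ _

theorem continuous_evalInt_apply [Finite σ] (f : TateAlgebra K σ) :
    Continuous fun x : σ → ℤ_[p] => evalInt K x f :=
  continuous_aeval_apply (fun (x : σ → ℤ_[p]) i => algebraMap ℚ_[p] K (x i))
    (fun i => (algebraMap_isometry ℚ_[p] K).continuous.comp
      (continuous_subtype_val.comp (continuous_apply i))) _ f

/-- A Tate series vanishing on `ℤ_p ^ σ` is zero: its homogeneous part of lowest degree vanishes at
`y ∈ ℕ ^ σ`, as the values at `p ^ N y` show for large `N`. -/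
theorem eq_zero_of_evalInt_eq_zero [Finite σ] (f : TateAlgebra K σ)
    (h : ∀ x : σ → ℤ_[p], evalInt K x f = 0) : f = 0 := by
  classical
  by_contra hf
  have hex : ∃ m, ∃ I : σ →₀ ℕ, coeff I f ≠ 0 ∧ I.degree = m := by
    by_contra! hne
    exact hf (ext fun I => by_contra fun hI => hne _ I hI rfl)
  obtain ⟨I₀, hI₀, hdeg⟩ := Nat.find_spec hex
  set m := Nat.find hex with hm
  have hmin : ∀ I : σ →₀ ℕ, I.degree < m → coeff I f = 0 := fun I hI => by
    by_contra hne
    exact Nat.find_min hex hI ⟨I, hne, rfl⟩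
  let S : Finset (σ →₀ ℕ) := (Finsupp.finite_of_degree_eq (σ := σ) m).toFinset
  have hS : ∀ I, I ∈ S ↔ I.degree = m := fun I => by simp [S]
  -- the homogeneous part of lowest degree
  let P : MvPolynomial σ K := ∑ I ∈ S, MvPolynomial.monomial I (coeff I f)
  have hchar : CharZero K := charZero_of_injective_algebraMap (algebraMap ℚ_[p] K).injective
  have hnp : ‖(p : K)‖ < 1 := by
    rw [← map_natCast (algebraMap ℚ_[p] K), norm_algebraMap']
    exact Padic.norm_p_lt_one
  have hp0 : (p : K) ≠ 0 := by exact_mod_cast hp.out.ne_zero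
  have hP : P = 0 := by
    refine MvPolynomial.funext_set (fun _ => Set.range ((↑) : ℕ → K))
      (fun _ => Set.infinite_range_of_injective Nat.cast_injective) fun y hy => ?_
    choose a ha using fun i => hy i trivial
    have hyn : ∀ i, ‖y i‖ ≤ 1 := fun i => by
      rw [← ha i, ← map_natCast (algebraMap ℚ_[p] K), norm_algebraMap']
      simpa using (a i : ℤ_[p]).2
    rw [map_zero]
    have hPy : MvPolynomial.eval y P = ∑ I ∈ S, coeff I f • I.prod fun i n => y i ^ n := by
      simp only [P, map_sum, MvPolynomial.eval_monomial, smul_eq_mul]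
    -- at `p ^ N y` the terms of degree `m` add up to `p ^ (N m) P(y)`, and the terms of larger
    -- degree are smaller by a factor `p ^ N`
    have hbound : ∀ N : ℕ, ‖MvPolynomial.eval y P‖ ≤ ‖f‖ * ‖(p : K)‖ ^ N := by
      intro N
      have h1 := h fun i => (p : ℤ_[p]) ^ N * a i
      have hcoord : ∀ i, (p : K) ^ N * y i =
          algebraMap ℚ_[p] K (((p : ℤ_[p]) ^ N * a i : ℤ_[p]) : ℚ_[p]) := by
        intro i
        rw [← ha i, PadicInt.coe_mul, PadicInt.coe_pow, PadicInt.coe_natCast, PadicInt.coe_natCast,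
          map_mul, map_pow, map_natCast, map_natCast]
      have hle : ∀ i, ‖(p : K) ^ N * y i‖ ≤ 1 := fun i => by
        rw [norm_mul, norm_pow]
        exact mul_le_one₀ (pow_le_one₀ (norm_nonneg _) hnp.le) (norm_nonneg _) (hyn i)
      have h2 : (∑' I : σ →₀ ℕ, coeff I f • I.prod fun i n => ((p : K) ^ N * y i) ^ n) = 0 :=
        (tsum_congr fun I => congrArg (coeff I f • ·)
          (Finsupp.prod_congr fun i _ => congrArg (· ^ I i) (hcoord i))).trans h1
      have hprod : ∀ I : σ →₀ ℕ, (I.prod fun i n => ((p : K) ^ N * y i) ^ n) =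
          (p : K) ^ (N * I.degree) * I.prod fun i n => y i ^ n := fun I => by
        simp only [mul_pow, Finsupp.prod_mul]
        congr 1
        rw [Finsupp.prod, Finsupp.degree_apply, Finset.mul_sum, ← Finset.prod_pow_eq_pow_sum]
        simp only [pow_mul]
      have hsum := summable_eval _ hle f
      rw [← hsum.sum_add_tsum_compl (s := S)] at h2
      have h3 : ∑ I ∈ S, (coeff I f • I.prod fun i n => ((p : K) ^ N * y i) ^ n) =
          (p : K) ^ (N * m) * MvPolynomial.eval y P := by
        rw [hPy, Finset.mul_sum]
        refine Finset.sum_congr rfl fun I hI => ?_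
        rw [hprod, (hS I).1 hI, smul_eq_mul, smul_eq_mul]
        ring
      rw [h3, add_eq_zero_iff_eq_neg] at h2
      have h4 : ‖(p : K) ^ (N * m) * MvPolynomial.eval y P‖ ≤ ‖f‖ * ‖(p : K)‖ ^ (N * (m + 1)) := by
        rw [h2, norm_neg]
        refine IsUltrametricDist.norm_tsum_le_of_forall_le_of_nonneg
          (mul_nonneg (norm_nonneg f) (pow_nonneg (norm_nonneg _) _)) fun I => ?_
        rcases lt_or_ge (I : σ →₀ ℕ).degree m with hlt | hge
        · rw [hmin _ hlt, zero_smul, norm_zero]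
          positivity
        · have hgt : m + 1 ≤ (I : σ →₀ ℕ).degree :=
            lt_of_le_of_ne hge fun he => I.2 (by simpa using (hS _).2 he.symm)
          rw [hprod, smul_eq_mul, norm_mul, norm_mul, norm_pow]
          refine mul_le_mul (norm_coeff_le f _) ?_ (by positivity) (norm_nonneg f)
          refine (mul_le_of_le_one_right (by positivity) (norm_monomial_le y hyn _)).trans ?_
          exact pow_le_pow_of_le_one (norm_nonneg _) hnp.le (Nat.mul_le_mul_left N hgt)
      rw [norm_mul, norm_pow, mul_add, mul_one, pow_add, mul_left_comm] at h4
      exact le_of_mul_le_mul_left h4 (pow_pos (norm_pos_iff.2 hp0) _)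
    have hlim : Tendsto (fun N : ℕ => ‖f‖ * ‖(p : K)‖ ^ N) atTop (𝓝 0) := by
      simpa using (tendsto_pow_atTop_nhds_zero_of_lt_one (norm_nonneg _) hnp).const_mul ‖f‖
    exact norm_le_zero_iff.1 (ge_of_tendsto' hlim hbound)
  refine hI₀ ?_
  have := congrArg (MvPolynomial.coeff I₀) hP
  simp only [P, MvPolynomial.coeff_sum, MvPolynomial.coeff_monomial, MvPolynomial.coeff_zero,
    Finset.sum_ite_eq', (hS I₀).2 hdeg, if_true] at this
  exact this

theorem ext_evalInt [Finite σ] {f g : TateAlgebra K σ}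
    (h : ∀ x : σ → ℤ_[p], evalInt K x f = evalInt K x g) : f = g :=
  sub_eq_zero.1 (eq_zero_of_evalInt_eq_zero (p := p) _ fun x => by rw [map_sub, h, sub_self])

end Identity

end TateAlgebra

/-! ### Coordinates of products of powers are Tate series -/

section Analytic

open TateAlgebra

/-- The falling factorial `u (u - 1) ⋯ (u - m + 1)`. -/
def fallingFactorial {B : Type*} [CommRing B] (u : B) (m : ℕ) : B := (descPochhammer B m).eval u

theorem map_fallingFactorial {B B' : Type*} [CommRing B] [CommRing B'] (φ : B →+* B') (u : B)
    (m : ℕ) : φ (fallingFactorial u m) = fallingFactorial (φ u) m := by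
  rw [fallingFactorial, fallingFactorial, ← descPochhammer_map φ, Polynomial.eval_map,
    Polynomial.eval₂_at_apply]

theorem fallingFactorial_natCast {B : Type*} [CommRing B] (a m : ℕ) :
    fallingFactorial (a : B) m = (m.factorial * a.choose m : ℕ) := by
  rw [fallingFactorial, descPochhammer_eval_eq_descFactorial,
    Nat.descFactorial_eq_factorial_mul_choose]

theorem norm_natCast_le_one {B : Type*} [NormedCommRing B] [NormOneClass B] [IsUltrametricDist B]
    (n : ℕ) : ‖(n : B)‖ ≤ 1 := by
  induction n with
  | zero => simp
  | succ n ih =>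
    rw [Nat.cast_succ]
    exact (IsUltrametricDist.norm_add_le_max _ _).trans (max_le ih norm_one.le)

theorem norm_fallingFactorial_le {B : Type*} [NormedCommRing B] [NormOneClass B]
    [IsUltrametricDist B] {u : B} (hu : ‖u‖ ≤ 1) (m : ℕ) : ‖fallingFactorial u m‖ ≤ 1 := by
  rw [fallingFactorial, descPochhammer_eval_eq_prod_range]
  refine (Finset.norm_prod_le _ _).trans (Finset.prod_le_one (fun _ _ => norm_nonneg _) ?_)
  intro j _
  rw [sub_eq_add_neg]
  refine (IsUltrametricDist.norm_add_le_max _ _).trans (max_le hu ?_)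
  rw [norm_neg]
  exact norm_natCast_le_one j

variable {p : ℕ} [hp : Fact p.Prime]

/-- Divisibility of `c` by `p ^ (m + v(s!))` with `s = ∑ α_i` gives `|c / α!| ≤ p ^ (-m)`, since
`α!` divides `s!`. -/
theorem norm_div_factorial_le {n : ℕ} (α : Fin n → ℕ) {c : ℤ_[p]} {m : ℕ}
    (hc : (p : ℤ_[p]) ^ (m + padicValNat p (∑ i, α i).factorial) ∣ c) :
    ‖(c : ℚ_[p]) / ((∏ i, (α i).factorial : ℕ) : ℚ_[p])‖ ≤ (p : ℝ) ^ (-(m : ℤ)) := by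
  have hp0 : (0 : ℝ) < p := by exact_mod_cast hp.out.pos
  obtain ⟨q, hq⟩ := Nat.prod_factorial_dvd_factorial_sum Finset.univ α
  set A := ∏ i, (α i).factorial with hA
  have hA0 : A ≠ 0 := Finset.prod_ne_zero_iff.2 fun i _ => Nat.factorial_ne_zero _
  have h1 : ‖c‖ ≤ (p : ℝ) ^ (-((m + padicValNat p (∑ i, α i).factorial : ℕ) : ℤ)) :=
    (PadicInt.norm_le_pow_iff_mem_span_pow _ _).2 (Ideal.mem_span_singleton.2 hc)
  have h2 : ‖((∑ i, α i).factorial : ℚ_[p])‖ =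
      (p : ℝ) ^ (-(padicValNat p (∑ i, α i).factorial : ℤ)) := by
    rw [Padic.norm_eq_zpow_neg_valuation (by exact_mod_cast Nat.factorial_ne_zero _),
      Padic.valuation_natCast]
  have h3 : ‖((∑ i, α i).factorial : ℚ_[p])‖ ≤ ‖(A : ℚ_[p])‖ := by
    rw [hq, Nat.cast_mul, norm_mul]
    exact mul_le_of_le_one_right (norm_nonneg _) (norm_natCast_le_one q)
  have hApos : 0 < ‖(A : ℚ_[p])‖ := norm_pos_iff.2 (by exact_mod_cast hA0)
  rw [norm_div, div_le_iff₀ hApos]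
  refine le_trans (le_trans h1 (le_of_eq ?_)) (mul_le_mul_of_nonneg_left h3 (by positivity))
  rw [h2, ← zpow_add₀ hp0.ne']
  congr 1
  push_cast
  ring

/-- A Newton series `∑ c_α binom(x, α)` whose coefficients satisfy `c_α / α! → 0` and
`|c_α / α!| ≤ 1` is a Tate series of norm at most one. -/
theorem exists_tate_of_newton {n : ℕ} (c : (Fin n → ℕ) → ℚ_[p])
    (hle : ∀ α, ‖c α / ((∏ i, (α i).factorial : ℕ) : ℚ_[p])‖ ≤ 1)
    (hlim : Tendsto (fun α => c α / ((∏ i, (α i).factorial : ℕ) : ℚ_[p])) cofinite (𝓝 0)) :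
    ∃ F : TateAlgebra ℚ_[p] (Fin n), ‖F‖ ≤ 1 ∧ ∀ (a : Fin n → ℕ) (N : ℕ), (∀ i, a i ≤ N) →
      evalInt ℚ_[p] (fun i => (a i : ℤ_[p])) F =
        ∑ α : Fin n → Fin (N + 1), ((∏ i, (a i).choose (α i) : ℕ) : ℚ_[p]) * c fun i => α i := by
  -- `binom(Z, α)` is the product of falling factorials, which have norm at most `1`, over `α!`
  let t : (Fin n → ℕ) → TateAlgebra ℚ_[p] (Fin n) := fun α =>
    (c α / ((∏ i, (α i).factorial : ℕ) : ℚ_[p])) • ∏ i, fallingFactorial (X i) (α i)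
  have ht : ∀ α, ‖t α‖ ≤ ‖c α / ((∏ i, (α i).factorial : ℕ) : ℚ_[p])‖ := fun α => by
    refine (norm_smul_le _ _).trans (mul_le_of_le_one_right (norm_nonneg _) ?_)
    exact (Finset.norm_prod_le _ _).trans (Finset.prod_le_one (fun _ _ => norm_nonneg _)
      fun i _ => norm_fallingFactorial_le (norm_X_le i) _)
  have hsum : Summable t := NonarchimedeanAddGroup.summable_of_tendsto_cofinite_zero
    (squeeze_zero_norm ht (tendsto_zero_iff_norm_tendsto_zero.1 hlim))
  refine ⟨∑' α, t α, IsUltrametricDist.norm_tsum_le_of_forall_le_of_nonneg zero_le_one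
    fun α => (ht α).trans (hle α), fun a N haN => ?_⟩
  rw [hsum.map_tsum (evalInt ℚ_[p] fun i => (a i : ℤ_[p])) (continuous_evalInt _)]
  have hterm : ∀ α, evalInt ℚ_[p] (fun i => (a i : ℤ_[p])) (t α) =
      ((∏ i, (a i).choose (α i) : ℕ) : ℚ_[p]) * c α := fun α => by
    have hne : ((∏ i, (α i).factorial : ℕ) : ℚ_[p]) ≠ 0 :=
      Nat.cast_ne_zero.2 (Finset.prod_ne_zero_iff.2 fun i _ => Nat.factorial_ne_zero _)
    have h1 : ∀ i, evalInt ℚ_[p] (fun i => (a i : ℤ_[p])) (fallingFactorial (X i) (α i)) =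
        ((α i).factorial * (a i).choose (α i) : ℕ) := fun i => by
      have h2 := map_fallingFactorial (evalInt ℚ_[p] fun i => (a i : ℤ_[p])).toRingHom
        (X i : TateAlgebra ℚ_[p] (Fin n)) (α i)
      have h3 : (evalInt ℚ_[p] fun i => (a i : ℤ_[p])).toRingHom
          (X i : TateAlgebra ℚ_[p] (Fin n)) = (a i : ℚ_[p]) := by
        refine (evalInt_X _ i).trans ?_
        simp
      rw [h3, fallingFactorial_natCast] at h2
      exact h2
    rw [map_smul, map_prod, Finset.prod_congr rfl fun i _ => h1 i, ← Nat.cast_prod,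
      Finset.prod_mul_distrib, Nat.cast_mul, smul_eq_mul]
    field_simp
  rw [tsum_congr hterm]
  -- `binom(a, α)` vanishes unless `α ≤ a ≤ N`
  have hinj : Function.Injective fun (α : Fin n → Fin (N + 1)) i => (α i : ℕ) :=
    fun α β h => funext fun i => Fin.ext (congrFun h i)
  rw [← hinj.tsum_eq (f := fun α : Fin n → ℕ => ((∏ i, (a i).choose (α i) : ℕ) : ℚ_[p]) * c α),
    tsum_fintype]
  intro α hα
  have hαN : ∀ i, α i < N + 1 := fun i => by
    by_contra hlt
    refine hα ?_
    have := haN i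
    dsimp only
    rw [Finset.prod_eq_zero (Finset.mem_univ i) (Nat.choose_eq_zero_of_lt (by omega)),
      Nat.cast_zero, zero_mul]
  exact ⟨fun i => ⟨α i, hαN i⟩, rfl⟩

variable {H : Type*} [Group H] [TopologicalSpace H] [IsTopologicalGroup H]
  {ω : PValuation p H} {d : ℕ}

/-- If `P : ℤ_p ^ n → H` is continuous and `P(a) = g₁ ^ a₁ ⋯ g_n ^ a_n` for natural exponents, then
the coordinates of `P` with respect to an ordered basis are Tate series of norm at most one.
The Newton coefficients `c_α` of a coordinate `k` have valuation at least
`∑ α_i ω g_i - ω h_k`; since `ω g_i > 1 / (p - 1)` and `ω h_k ≤ p / (p - 1)`, the quotients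
`c_α / α!` tend to zero and have valuation greater than `-1`. -/
theorem OrderedBasis.exists_tate_coord (b : OrderedBasis ω d) (hω : ω.DefinesTopology)
    (hsat : ω.IsSaturated) {n : ℕ} (g : Fin n → H) (P : (Fin n → ℤ_[p]) → H) (hP : Continuous P)
    (hPg : ∀ a : Fin n → ℕ, P (fun i => (a i : ℤ_[p])) = (List.ofFn fun i => g i ^ a i).prod)
    (k : Fin d) :
    ∃ F : TateAlgebra ℚ_[p] (Fin n), ‖F‖ ≤ 1 ∧
      ∀ x, evalInt ℚ_[p] x F = (b.coord (P x) k : ℚ_[p]) := by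
  have hp1 : (0 : ℝ) < (p : ℝ) - 1 := by
    have : (1 : ℝ) < p := by exact_mod_cast hp.out.one_lt
    linarith
  -- a common lower bound for the values of the `g i`
  obtain ⟨ρ, hρ1, hρ⟩ : ∃ ρ : ℝ, 1 / ((p : ℝ) - 1) < ρ ∧ ∀ i, (ρ : WithTop ℝ) ≤ ω.val (g i) := by
    have hex : ∀ i, ∃ r : ℝ, 1 / ((p : ℝ) - 1) < r ∧ (r : WithTop ℝ) ≤ ω.val (g i) := fun i => by
      have hlt := ω.lt_val (g i)
      rcases eq_or_ne (ω.val (g i)) ⊤ with htop | htop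
      · exact ⟨1 / ((p : ℝ) - 1) + 1, by linarith, by rw [htop]; exact le_top⟩
      · obtain ⟨r, hr⟩ := WithTop.ne_top_iff_exists.1 htop
        rw [← hr, WithTop.coe_lt_coe] at hlt
        exact ⟨r, hlt, hr.le⟩
    choose r hr1 hr2 using hex
    rcases isEmpty_or_nonempty (Fin n) with he | hne
    · exact ⟨1 / ((p : ℝ) - 1) + 1, by linarith, fun i => he.elim i⟩
    · obtain ⟨j, hj⟩ := Finite.exists_min r
      exact ⟨r j, hr1 j, fun i => (WithTop.coe_le_coe.2 (hj i)).trans (hr2 i)⟩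
  -- the Newton coefficients
  let c : (Fin n → ℕ) → ℤ_[p] := fun α => linExt ℤ (fun g => b.coord g k)
    (List.ofFn fun i => (MonoidAlgebra.of ℤ H (g i) - 1) ^ α i).prod
  have hmem : ∀ α : Fin n → ℕ, (List.ofFn fun i => (MonoidAlgebra.of ℤ H (g i) - 1) ^ α i).prod ∈
      ω.augFiltration ((∑ i, α i : ℕ) * ρ) := fun α => by
    have hlist : (List.ofFn fun i => (MonoidAlgebra.of ℤ H (g i) - 1) ^ α i).prod =
        (List.ofFn fun i =>
          List.replicate (α i) (MonoidAlgebra.of ℤ H (g i) - 1)).flatten.prod := by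
      rw [List.prod_flatten, List.map_ofFn]
      simp only [Function.comp_def, List.prod_replicate]
    have h1 := PValuation.prod_mem_augFiltration (ω := ω) (ρ := ρ)
      (List.ofFn fun i => List.replicate (α i) (MonoidAlgebra.of ℤ H (g i) - 1)).flatten (by
        intro u hu
        obtain ⟨l, hl, hul⟩ := List.mem_flatten.1 hu
        obtain ⟨i, rfl⟩ := List.mem_ofFn.1 hl
        rw [List.eq_of_mem_replicate hul]
        exact PValuation.of_sub_one_mem_augFiltration (hρ i))
    rw [List.length_flatten, List.map_ofFn, List.sum_ofFn] at h1
    rw [hlist]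
    simpa [Function.comp_def] using h1
  have hbound : ∀ (α : Fin n → ℕ) (m : ℕ), ∑ i, α i ≠ 0 →
      m + ((∑ i, α i : ℕ) - 1 : ℝ) / (p - 1) < (∑ i, α i : ℕ) * ρ - b.weight k + 1 →
      ‖(c α : ℚ_[p]) / ((∏ i, (α i).factorial : ℕ) : ℚ_[p])‖ ≤ (p : ℝ) ^ (-(m : ℤ)) := by
    intro α m hα hm
    refine norm_div_factorial_le α (b.pow_dvd_linExt_coord hω k (hmem α) (lt_of_le_of_lt ?_ hm))
    rw [Nat.cast_add, add_le_add_iff_left, le_div_iff₀ hp1]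
    -- Legendre: `(p - 1) v(s!) ≤ s - 1` for `s > 0`
    have h1 := sub_one_mul_padicValNat_factorial_lt_of_ne_zero p hα
    have h2 : (p - 1) * padicValNat p (∑ i, α i).factorial + 1 ≤ ∑ i, α i := h1
    have h3 : (((p - 1) * padicValNat p (∑ i, α i).factorial + 1 : ℕ) : ℝ) ≤ (∑ i, α i : ℕ) :=
      Nat.cast_le.2 h2
    push_cast [Nat.cast_sub hp.out.one_lt.le] at h3 ⊢
    linarith
  -- the constant coefficient is the coordinate of `1`
  have hzero : ∀ α : Fin n → ℕ, ∑ i, α i = 0 → c α = 0 := fun α hα => by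
    have h0 : ∀ i, α i = 0 := fun i => Finset.sum_eq_zero_iff.1 hα i (Finset.mem_univ i)
    simp only [c, h0, pow_zero, List.ofFn_const, List.prod_replicate, one_pow]
    rw [← map_one (MonoidAlgebra.of ℤ H), linExt_of, b.coord_one hω]
  have hw := b.weight_le hω hsat k
  have hw' : b.weight k ≤ 1 + 1 / ((p : ℝ) - 1) := hw.trans_eq (by field_simp; ring)
  have hdiv : ∀ s : ℝ, (s - 1) / ((p : ℝ) - 1) = s * (1 / (p - 1)) - 1 / (p - 1) := fun s => by
    field_simp
  obtain ⟨F, hF, hFe⟩ := exists_tate_of_newton (fun α => (c α : ℚ_[p])) (fun α => by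
      by_cases hα : ∑ i, α i = 0
      · rw [hzero α hα]; simp
      · have h1 := hbound α 0 hα (by
          rw [hdiv]
          have hpos : (0 : ℝ) < (∑ i, α i : ℕ) := Nat.cast_pos.2 (Nat.pos_of_ne_zero hα)
          push_cast at hpos ⊢
          nlinarith)
        simpa using h1) (by
      rw [Metric.tendsto_nhds]
      intro ε hε
      obtain ⟨m, hm⟩ := PadicInt.exists_pow_neg_lt p hε
      -- `|α| > L` forces the quotient to have valuation at least `m`
      obtain ⟨L, hL⟩ := exists_nat_gt ((m + b.weight k) / (ρ - 1 / ((p : ℝ) - 1)))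
      rw [div_lt_iff₀ (by linarith)] at hL
      refine ((Set.finite_Iic fun _ : Fin n => L).subset fun α hα => ?_)
      by_contra hnot
      refine hα ?_
      obtain ⟨i, hi⟩ : ∃ i, L < α i := by
        by_contra! hall
        exact hnot hall
      have hle : L < ∑ i, α i :=
        hi.trans_le (Finset.single_le_sum (fun _ _ => Nat.zero_le _) (Finset.mem_univ i))
      change dist _ _ < ε
      rw [dist_zero_right]
      refine (hbound α m (by omega) ?_).trans_lt hm
      rw [hdiv]
      have hle' : (L : ℝ) ≤ (∑ i, α i : ℕ) := Nat.cast_le.2 hle.le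
      have hpos : 0 < ρ - 1 / ((p : ℝ) - 1) := by linarith
      have h1 := mul_le_mul_of_nonneg_right hle' hpos.le
      have h2 : 0 < 1 / ((p : ℝ) - 1) := by positivity
      linarith)
  -- both sides are continuous in `x`, so it suffices to compare them on natural tuples
  refine ⟨F, hF, fun x => ?_⟩
  refine congrFun ((denseRange_natCast_pi p n).equalizer (continuous_evalInt_apply F)
    (continuous_subtype_val.comp ((continuous_apply k).comp (b.continuous_coord.comp hP)))
    (funext fun a => ?_)) x
  -- at natural exponents the Newton series is the Newton expansion in the group ring
  have haN : ∀ i, a i ≤ ∑ j, a j := fun i => Finset.single_le_sum (fun _ _ => Nat.zero_le _)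
      (Finset.mem_univ i)
  refine (hFe a _ haN).trans ?_
  change _ = ((b.coord (P fun i => (a i : ℤ_[p])) k : ℤ_[p]) : ℚ_[p])
  rw [hPg]
  have h1 := congrArg (linExt ℤ fun g => b.coord g k)
    (prod_ofFn_pow_eq_sum (fun i => MonoidAlgebra.of ℤ H (g i)) a haN)
  have h2 : (List.ofFn fun i => MonoidAlgebra.of ℤ H (g i) ^ a i).prod =
      MonoidAlgebra.of ℤ H (List.ofFn fun i => g i ^ a i).prod := by
    rw [map_list_prod, List.map_ofFn]
    simp only [Function.comp_def, map_pow]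
  rw [h2, linExt_of, map_sum] at h1
  simp only [linExt_natCast_mul] at h1
  rw [h1]
  refine Eq.trans (Finset.sum_congr rfl fun α _ => ?_) (map_sum PadicInt.Coe.ringHom _ _).symm
  rw [map_mul, map_natCast]
  rfl

end Analytic

/-! ### Rational points of closed balls -/

namespace TateAlgebra

section Points

variable {K : Type*} [NormedField K] [IsUltrametricDist K] [CompleteSpace K] {σ τ σ' τ' ρ : Type*}

theorem rename_X (e : σ → τ) (i : σ) :
    rename e (X i : TateAlgebra K σ) = X (e i) := aeval_X _ _ _

theorem liftPoint_X_inl (φ : TateAlgebra K σ →ₐ[K] K) (ψ : TateAlgebra K τ →ₐ[K] K) (i : σ) :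
    liftPoint φ ψ (X (Sum.inl i)) = φ (X i) := aeval_X _ _ _

theorem liftPoint_X_inr (φ : TateAlgebra K σ →ₐ[K] K) (ψ : TateAlgebra K τ →ₐ[K] K) (j : τ) :
    liftPoint φ ψ (X (Sum.inr j)) = ψ (X j) := aeval_X _ _ _

theorem liftPoint_comp_inl (φ : TateAlgebra K σ →ₐ[K] K) (ψ : TateAlgebra K τ →ₐ[K] K) :
    (liftPoint φ ψ).comp inl = φ :=
  point_ext fun i => by rw [AlgHom.comp_apply, inl, rename_X, liftPoint_X_inl]

theorem liftPoint_comp_inr (φ : TateAlgebra K σ →ₐ[K] K) (ψ : TateAlgebra K τ →ₐ[K] K) :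
    (liftPoint φ ψ).comp inr = ψ :=
  point_ext fun j => by rw [AlgHom.comp_apply, inr, rename_X, liftPoint_X_inr]

theorem eq_liftPoint (χ : TateAlgebra K (σ ⊕ τ) →ₐ[K] K) :
    χ = liftPoint (χ.comp inl) (χ.comp inr) := by
  refine point_ext fun k => ?_
  cases k with
  | inl i => rw [liftPoint_X_inl, AlgHom.comp_apply, inl, rename_X]
  | inr j => rw [liftPoint_X_inr, AlgHom.comp_apply, inr, rename_X]

theorem point_comp_lift (χ : TateAlgebra K ρ →ₐ[K] K)
    (φ : TateAlgebra K σ →ₐ[K] TateAlgebra K ρ) (ψ : TateAlgebra K τ →ₐ[K] TateAlgebra K ρ) :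
    χ.comp (lift φ ψ) = liftPoint (χ.comp φ) (χ.comp ψ) := by
  refine point_ext fun k => ?_
  cases k with
  | inl i =>
    rw [liftPoint_X_inl, AlgHom.comp_apply, AlgHom.comp_apply]
    exact congrArg χ (aeval_X _ _ _)
  | inr j =>
    rw [liftPoint_X_inr, AlgHom.comp_apply, AlgHom.comp_apply]
    exact congrArg χ (aeval_X _ _ _)

theorem liftPoint_comp_map (φ : TateAlgebra K σ' →ₐ[K] K) (ψ : TateAlgebra K τ' →ₐ[K] K)
    (α : TateAlgebra K σ →ₐ[K] TateAlgebra K σ') (β : TateAlgebra K τ →ₐ[K] TateAlgebra K τ') :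
    (liftPoint φ ψ).comp (map α β) = liftPoint (φ.comp α) (ψ.comp β) := by
  rw [map, point_comp_lift, ← AlgHom.comp_assoc, ← AlgHom.comp_assoc, liftPoint_comp_inl,
    liftPoint_comp_inr]

theorem liftPoint_comp_rename_sumAssoc (φ : TateAlgebra K σ →ₐ[K] K)
    (ψ : TateAlgebra K τ →ₐ[K] K) (χ : TateAlgebra K ρ →ₐ[K] K) :
    (liftPoint φ (liftPoint ψ χ)).comp (rename (Equiv.sumAssoc σ τ ρ)) =
      liftPoint (liftPoint φ ψ) χ := by
  refine point_ext fun k => ?_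
  rw [AlgHom.comp_apply, rename_X]
  rcases k with (i | j) | l
  · rw [Equiv.sumAssoc_apply_inl_inl, liftPoint_X_inl, liftPoint_X_inl, liftPoint_X_inl]
  · rw [Equiv.sumAssoc_apply_inl_inr, liftPoint_X_inr, liftPoint_X_inl, liftPoint_X_inl,
      liftPoint_X_inr]
  · rw [Equiv.sumAssoc_apply_inr, liftPoint_X_inr, liftPoint_X_inr, liftPoint_X_inr]

omit [CompleteSpace K] in
theorem point_comp_ofId (χ : TateAlgebra K τ →ₐ[K] K) (ε : TateAlgebra K σ →ₐ[K] K) :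
    χ.comp ((Algebra.ofId K _).comp ε) = ε :=
  AlgHom.ext fun f => χ.commutes (ε f)

end Points

section PadicPoints

variable {p : ℕ} [hp : Fact p.Prime] {σ τ : Type*}

theorem eq_evalInt (φ : TateAlgebra ℚ_[p] σ →ₐ[ℚ_[p]] ℚ_[p]) :
    φ = evalInt ℚ_[p] fun i => (⟨φ (X i), norm_point_X_le φ i⟩ : ℤ_[p]) :=
  point_ext fun i =>
    (evalInt_X (K := ℚ_[p]) (fun i => (⟨φ (X i), norm_point_X_le φ i⟩ : ℤ_[p])) i).symm

/-- Homomorphisms between Tate algebras over `ℚ_p` which agree on rational points are equal. -/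
theorem algHom_ext_point [Finite τ]
    {φ ψ : TateAlgebra ℚ_[p] σ →ₐ[ℚ_[p]] TateAlgebra ℚ_[p] τ}
    (h : ∀ χ : TateAlgebra ℚ_[p] τ →ₐ[ℚ_[p]] ℚ_[p], χ.comp φ = χ.comp ψ) : φ = ψ :=
  AlgHom.ext fun f => ext_evalInt (p := p) fun x => DFunLike.congr_fun (h (evalInt ℚ_[p] x)) f

end PadicPoints

/-! ### Base change -/

section BaseChange

variable {p : ℕ} [hp : Fact p.Prime] (K : Type*) [NormedField K] [IsUltrametricDist K]
  [CompleteSpace K] [NormedAlgebra ℚ_[p] K] {σ : Type*}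

/-- A Tate series over `ℚ_p`, considered over `K`. -/
def baseChange (f : TateAlgebra ℚ_[p] σ) : TateAlgebra K σ :=
  ⟨fun I => algebraMap ℚ_[p] K (coeff I f), by
    have h := ((algebraMap_isometry ℚ_[p] K).continuous.tendsto 0).comp f.tendsto_coeff
    rwa [map_zero] at h⟩

omit [CompleteSpace K] in
theorem coeff_baseChange (f : TateAlgebra ℚ_[p] σ) (I : σ →₀ ℕ) :
    coeff I (baseChange K f) = algebraMap ℚ_[p] K (coeff I f) := rfl

omit [CompleteSpace K] in
theorem norm_baseChange_le (f : TateAlgebra ℚ_[p] σ) : ‖baseChange K f‖ ≤ ‖f‖ :=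
  norm_le fun I => by rw [coeff_baseChange, norm_algebraMap']; exact norm_coeff_le f I

theorem evalInt_baseChange (f : TateAlgebra ℚ_[p] σ) (x : σ → ℤ_[p]) :
    evalInt K x (baseChange K f) = algebraMap ℚ_[p] K (evalInt ℚ_[p] x f) := by
  have h := (summable_eval (fun i => algebraMap ℚ_[p] ℚ_[p] (x i)) (norm_padicInt_le_one x)
    f).map_tsum (algebraMap ℚ_[p] K) (algebraMap_isometry ℚ_[p] K).continuous
  refine Eq.trans (tsum_congr fun I => ?_) h.symm
  rw [coeff_baseChange, smul_eq_mul, smul_eq_mul, map_mul, map_finsuppProd]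
  simp only [map_pow, Algebra.algebraMap_self, RingHom.id_apply]

end BaseChange

end TateAlgebra

/-! ### Rigid analytic groups and their points -/

section GroupPoints

open TateAlgebra

variable {p : ℕ} [hp : Fact p.Prime] {σ : Type*}

namespace RigidBallGroup

theorem mulPoint_counit (G : RigidBallGroup ℚ_[p] σ) (φ : TateAlgebra ℚ_[p] σ →ₐ[ℚ_[p]] ℚ_[p]) :
    G.mulPoint G.counit φ = φ := by
  have h := congrArg (fun α => φ.comp α) G.counit_left
  rw [← AlgHom.comp_assoc, point_comp_lift, point_comp_ofId, AlgHom.comp_id] at h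
  exact h

theorem mulPoint_antipode (G : RigidBallGroup ℚ_[p] σ)
    (φ : TateAlgebra ℚ_[p] σ →ₐ[ℚ_[p]] ℚ_[p]) :
    G.mulPoint (φ.comp G.antipode) φ = G.counit := by
  have h := congrArg (fun α => φ.comp α) G.antipode_left
  rw [← AlgHom.comp_assoc, point_comp_lift, point_comp_ofId, AlgHom.comp_id] at h
  exact h

/-- The axioms of a group object on a closed ball over `ℚ_p` may be checked on rational points. -/
def ofPoints [Finite σ] (comul : TateAlgebra ℚ_[p] σ →ₐ[ℚ_[p]] TateAlgebra ℚ_[p] (σ ⊕ σ))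
    (counit : TateAlgebra ℚ_[p] σ →ₐ[ℚ_[p]] ℚ_[p])
    (antipode : TateAlgebra ℚ_[p] σ →ₐ[ℚ_[p]] TateAlgebra ℚ_[p] σ)
    (assoc : ∀ φ ψ χ, (liftPoint ((liftPoint φ ψ).comp comul) χ).comp comul =
      (liftPoint φ ((liftPoint ψ χ).comp comul)).comp comul)
    (one_mul : ∀ φ, (liftPoint counit φ).comp comul = φ)
    (mul_one : ∀ φ, (liftPoint φ counit).comp comul = φ)
    (inv_mul : ∀ φ, (liftPoint (φ.comp antipode) φ).comp comul = counit)
    (mul_inv : ∀ φ, (liftPoint φ (φ.comp antipode)).comp comul = counit) :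
    RigidBallGroup ℚ_[p] σ where
  comul := comul
  counit := counit
  antipode := antipode
  coassoc := algHom_ext_point fun χ => by
    rw [eq_liftPoint χ, eq_liftPoint (χ.comp inr), ← AlgHom.comp_assoc, ← AlgHom.comp_assoc,
      ← AlgHom.comp_assoc, liftPoint_comp_rename_sumAssoc, liftPoint_comp_map, liftPoint_comp_map,
      AlgHom.comp_id, AlgHom.comp_id, assoc]
  counit_left := algHom_ext_point fun χ => by
    rw [← AlgHom.comp_assoc, point_comp_lift, point_comp_ofId, AlgHom.comp_id, one_mul]
  counit_right := algHom_ext_point fun χ => by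
    rw [← AlgHom.comp_assoc, point_comp_lift, point_comp_ofId, AlgHom.comp_id, mul_one]
  antipode_left := algHom_ext_point fun χ => by
    rw [← AlgHom.comp_assoc, point_comp_lift, point_comp_ofId, AlgHom.comp_id, inv_mul]
  antipode_right := algHom_ext_point fun χ => by
    rw [← AlgHom.comp_assoc, point_comp_lift, point_comp_ofId, AlgHom.comp_id, mul_inv]

end RigidBallGroup

end GroupPoints

/-! ### The rigid analytic group of an ordered basis -/

namespace OrderedBasis

open TateAlgebra

section Associated

variable {p : ℕ} [hp : Fact p.Prime] {H : Type*} [Group H] [TopologicalSpace H]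
  {ω : PValuation p H} {d : ℕ} (b : OrderedBasis ω d)

theorem pointCoord_evalInt (x : Fin d → ℤ_[p]) : pointCoord (evalInt ℚ_[p] x) = x :=
  funext fun i => Subtype.ext (evalInt_X x i)

theorem bijective_pointCoord :
    Function.Bijective (pointCoord (p := p) (d := d)) := by
  refine ⟨fun φ ψ h => point_ext fun i => ?_, fun x => ⟨_, pointCoord_evalInt x⟩⟩
  exact congrArg Subtype.val (congrFun h i)

theorem bijective_ofPoint : Function.Bijective b.ofPoint :=
  b.isHomeomorph.bijective.comp bijective_pointCoord

theorem coord_ofPoint (φ : TateAlgebra ℚ_[p] (Fin d) →ₐ[ℚ_[p]] ℚ_[p]) :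
    b.coord (b.ofPoint φ) = pointCoord φ :=
  b.coord_orderedProd _

/-- The comultiplication is determined by the product of points, the counit and the antipode by the
identity and the inverses of the group of points. -/
theorem IsAssociated.unique {G G' : RigidBallGroup ℚ_[p] (Fin d)} (hG : b.IsAssociated G)
    (hG' : b.IsAssociated G') : G = G' := by
  have hinj := b.bijective_ofPoint.injective
  have hmul : ∀ φ ψ, G.mulPoint φ ψ = G'.mulPoint φ ψ := fun φ ψ =>
    hinj (by rw [hG.2, hG'.2])
  have hone : ∀ {G : RigidBallGroup ℚ_[p] (Fin d)}, b.IsAssociated G →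
      b.ofPoint G.counit = 1 := fun {G} hG => by
    have h := hG.2 G.counit G.counit
    rw [G.mulPoint_counit] at h
    exact left_eq_mul.1 h
  have hinv : ∀ {G : RigidBallGroup ℚ_[p] (Fin d)}, b.IsAssociated G →
      ∀ φ, b.ofPoint (φ.comp G.antipode) = (b.ofPoint φ)⁻¹ := fun {G} hG φ => by
    have h := hG.2 (φ.comp G.antipode) φ
    rw [G.mulPoint_antipode, hone hG] at h
    exact eq_inv_of_mul_eq_one_left h.symm
  refine RigidBallGroup.ext (algHom_ext_point fun χ => ?_) (hinj ?_) (algHom_ext_point fun χ => ?_)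
  · rw [eq_liftPoint χ]
    exact hmul _ _
  · rw [hone hG, hone hG']
  · exact hinj (by rw [hinv hG, hinv hG'])

variable [IsTopologicalGroup H] (hω : ω.DefinesTopology) (hsat : ω.IsSaturated)

include hω hsat

/-- The substitution homomorphism representing, in the coordinates of an ordered basis, a continuous
map which is an ordered product of powers. -/
theorem exists_algHom {n : ℕ} (g : Fin n → H) (P : (Fin n → ℤ_[p]) → H) (hP : Continuous P)
    (hPg : ∀ a : Fin n → ℕ, P (fun i => (a i : ℤ_[p])) = (List.ofFn fun i => g i ^ a i).prod) :
    ∃ Φ : TateAlgebra ℚ_[p] (Fin d) →ₐ[ℚ_[p]] TateAlgebra ℚ_[p] (Fin n),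
      ∀ χ, b.ofPoint (χ.comp Φ) = P (pointCoord χ) := by
  choose F hF1 hF using b.exists_tate_coord hω hsat g P hP hPg
  refine ⟨aeval F hF1, fun χ => ?_⟩
  rw [← b.orderedProd_coord (P (pointCoord χ)), ofPoint]
  congr 1
  funext k
  refine Subtype.ext ?_
  rw [← hF k (pointCoord χ)]
  have h1 : χ = evalInt ℚ_[p] (pointCoord χ) := eq_evalInt χ
  rw [← h1]
  exact congrArg χ (aeval_X F hF1 k)

/-- The multiplication is analytic: the product of two ordered products is an ordered product of
`2d` powers. -/
theorem exists_comul : ∃ comul : TateAlgebra ℚ_[p] (Fin d) →ₐ[ℚ_[p]]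
    TateAlgebra ℚ_[p] (Fin d ⊕ Fin d), ∀ φ ψ,
      b.ofPoint ((liftPoint φ ψ).comp comul) = b.ofPoint φ * b.ofPoint ψ := by
  obtain ⟨Φ, hΦ⟩ := b.exists_algHom hω hsat (Fin.append b.elt b.elt)
    (fun x => orderedProd b.elt (fun i => x (Fin.castAdd d i)) *
      orderedProd b.elt (fun i => x (Fin.natAdd d i)))
    ((b.continuous_orderedProd.comp (by fun_prop)).mul
      (b.continuous_orderedProd.comp (by fun_prop)))
    (fun a => by
      rw [b.orderedProd_natCast hω fun i => a (Fin.castAdd d i),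
        b.orderedProd_natCast hω fun i => a (Fin.natAdd d i), ← List.prod_append,
        ← List.ofFn_fin_append]
      congr 2
      funext i
      refine Fin.addCases (fun i => ?_) (fun i => ?_) i
      · rw [Fin.append_left, Fin.append_left]
      · rw [Fin.append_right, Fin.append_right])
  refine ⟨(rename finSumFinEquiv.symm).comp Φ, fun φ ψ => ?_⟩
  rw [← AlgHom.comp_assoc, hΦ]
  have h1 : ∀ i, pointCoord ((liftPoint φ ψ).comp (rename finSumFinEquiv.symm))
      (Fin.castAdd d i) = pointCoord φ i := fun i => Subtype.ext (by
    refine (congrArg (liftPoint φ ψ) (rename_X _ _)).trans ?_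
    rw [finSumFinEquiv_symm_apply_castAdd, liftPoint_X_inl]
    rfl)
  have h2 : ∀ i, pointCoord ((liftPoint φ ψ).comp (rename finSumFinEquiv.symm))
      (Fin.natAdd d i) = pointCoord ψ i := fun i => Subtype.ext (by
    refine (congrArg (liftPoint φ ψ) (rename_X _ _)).trans ?_
    rw [finSumFinEquiv_symm_apply_natAdd, liftPoint_X_inr]
    rfl)
  simp only [h1, h2]
  rfl

/-- The inversion is analytic: the inverse of an ordered product is a product of powers of the
inverses in the reverse order. -/
theorem exists_antipode : ∃ antipode : TateAlgebra ℚ_[p] (Fin d) →ₐ[ℚ_[p]]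
    TateAlgebra ℚ_[p] (Fin d), ∀ φ, b.ofPoint (φ.comp antipode) = (b.ofPoint φ)⁻¹ := by
  obtain ⟨Φ, hΦ⟩ := b.exists_algHom hω hsat (fun i => (b.elt i.rev)⁻¹)
    (fun x => (orderedProd b.elt fun i => x i.rev)⁻¹)
    (b.continuous_orderedProd.comp (by fun_prop)).inv
    (fun a => by
      rw [b.orderedProd_natCast hω fun i => a i.rev, List.prod_inv_reverse, List.map_ofFn]
      refine congrArg List.prod (List.ext_getElem (by simp) fun i h₁ h₂ => ?_)
      have hi : i < d := by simpa using h₂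
      have hrev : (⟨d - 1 - i, by omega⟩ : Fin d) = Fin.rev ⟨i, hi⟩ :=
        Fin.ext (show d - 1 - i = d - (i + 1) by omega)
      simp [List.getElem_reverse, hrev])
  refine ⟨(rename Fin.rev).comp Φ, fun φ => ?_⟩
  rw [← AlgHom.comp_assoc, hΦ]
  have h1 : ∀ i : Fin d, pointCoord (φ.comp (rename Fin.rev)) i.rev = pointCoord φ i :=
    fun i => Subtype.ext (by
      refine (congrArg φ (rename_X _ _)).trans ?_
      rw [Fin.rev_rev]
      rfl)
  simp only [h1]
  rfl

theorem exists_isAssociated : ∃ G, b.IsAssociated G := by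
  obtain ⟨comul, hcomul⟩ := b.exists_comul hω hsat
  obtain ⟨antipode, hanti⟩ := b.exists_antipode hω hsat
  obtain ⟨counit, hcounit⟩ := b.bijective_ofPoint.surjective 1
  have hinj := b.bijective_ofPoint.injective
  refine ⟨RigidBallGroup.ofPoints comul counit antipode ?_ ?_ ?_ ?_ ?_,
    b.bijective_ofPoint, fun φ ψ => hcomul φ ψ⟩
  · exact fun φ ψ χ => hinj (by rw [hcomul, hcomul, hcomul, hcomul, mul_assoc])
  · exact fun φ => hinj (by rw [hcomul, hcounit, one_mul])
  · exact fun φ => hinj (by rw [hcomul, hcounit, mul_one])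
  · exact fun φ => hinj (by rw [hcomul, hanti, hcounit, inv_mul_cancel])
  · exact fun φ => hinj (by rw [hcomul, hanti, hcounit, mul_inv_cancel])

/-- The change of coordinates between two ordered bases. -/
theorem exists_transition (b' : OrderedBasis ω d) : ∃ Φ : TateAlgebra ℚ_[p] (Fin d) →ₐ[ℚ_[p]]
    TateAlgebra ℚ_[p] (Fin d), ∀ φ, b'.ofPoint (φ.comp Φ) = b.ofPoint φ :=
  b'.exists_algHom hω hsat b.elt _ b.continuous_orderedProd (b.orderedProd_natCast hω)

theorem existsUnique_groupIso (b' : OrderedBasis ω d) {G G' : RigidBallGroup ℚ_[p] (Fin d)}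
    (hG : b.IsAssociated G) (hG' : b'.IsAssociated G') :
    ∃! Θ : TateAlgebra ℚ_[p] (Fin d) ≃ₐ[ℚ_[p]] TateAlgebra ℚ_[p] (Fin d),
      G.IsGroupIso G' Θ ∧ ∀ φ, b'.ofPoint (φ.comp Θ.toAlgHom) = b.ofPoint φ := by
  obtain ⟨Φ, hΦ⟩ := b.exists_transition hω hsat b'
  obtain ⟨Ψ, hΨ⟩ := b'.exists_transition hω hsat b
  have hinj := b.bijective_ofPoint.injective
  have hinj' := b'.bijective_ofPoint.injective
  let Θ : TateAlgebra ℚ_[p] (Fin d) ≃ₐ[ℚ_[p]] TateAlgebra ℚ_[p] (Fin d) :=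
    AlgEquiv.ofAlgHom Φ Ψ
      (algHom_ext_point fun χ => hinj (by rw [← AlgHom.comp_assoc, hΨ, hΦ, AlgHom.comp_id]))
      (algHom_ext_point fun χ => hinj' (by rw [← AlgHom.comp_assoc, hΦ, hΨ, AlgHom.comp_id]))
  have hΘ : ∀ φ, b'.ofPoint (φ.comp Θ.toAlgHom) = b.ofPoint φ := hΦ
  refine ⟨Θ, ⟨algHom_ext_point fun χ => hinj' ?_, hΘ⟩, fun Θ' hΘ' => ?_⟩
  · rw [eq_liftPoint χ, ← AlgHom.comp_assoc, ← AlgHom.comp_assoc, hΘ, liftPoint_comp_map]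
    have h1 := hG.2 (χ.comp inl) (χ.comp inr)
    have h2 := hG'.2 ((χ.comp inl).comp Θ.toAlgHom) ((χ.comp inr).comp Θ.toAlgHom)
    rw [hΘ, hΘ] at h2
    exact h1.trans h2.symm
  · have h : Θ'.toAlgHom = Θ.toAlgHom :=
      algHom_ext_point fun χ => hinj' (by rw [hΘ'.2, hΘ])
    exact AlgEquiv.ext fun f => DFunLike.congr_fun h f

end Associated

/-! ### Rigid analytic functions -/

section Functions

variable {p : ℕ} [hp : Fact p.Prime] {H : Type*} [Group H] [TopologicalSpace H]
  {ω : PValuation p H} {d : ℕ} (b : OrderedBasis ω d)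
  (K : Type*) [NormedField K] [IsUltrametricDist K] [CompleteSpace K] [NormedAlgebra ℚ_[p] K]

theorem toFunction_apply (F : TateAlgebra K (Fin d)) (g : H) :
    b.toFunction K F g = evalInt K (b.coord g) F := rfl

theorem continuous_toFunction (F : TateAlgebra K (Fin d)) : Continuous (b.toFunction K F) :=
  (continuous_evalInt_apply F).comp b.continuous_coord

theorem toFunction_injective : Function.Injective (b.toFunction K) := fun F F' h =>
  ext_evalInt (p := p) fun x => by
    have := congrFun h (orderedProd b.elt x)
    rwa [toFunction_apply, toFunction_apply, coord_orderedProd] at this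

theorem gaussNorm_toFunction (F : TateAlgebra K (Fin d)) :
    b.gaussNorm K (b.toFunction K F) = ‖F‖ := by
  have h : {r | ∃ F', b.toFunction K F' = b.toFunction K F ∧ r = ‖F'‖} = {‖F‖} := by
    ext r
    constructor
    · rintro ⟨F', h1, rfl⟩
      rw [b.toFunction_injective K h1]
      rfl
    · rintro rfl
      exact ⟨F, rfl, rfl⟩
  rw [gaussNorm, h, csInf_singleton]

/-- Substituting the change of coordinates re-expands a rigid function with respect to another
ordered basis, without increasing the Gauss norm. -/
theorem exists_toFunction_eq [IsTopologicalGroup H] (hω : ω.DefinesTopology)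
    (hsat : ω.IsSaturated) (b' : OrderedBasis ω d) (F : TateAlgebra K (Fin d)) :
    ∃ F', b.toFunction K F' = b'.toFunction K F ∧ ‖F'‖ ≤ ‖F‖ := by
  obtain ⟨Φ, hΦ⟩ := b.exists_transition hω hsat b'
  have hΦ1 : ∀ i, ‖baseChange K (Φ (X i))‖ ≤ 1 := fun i =>
    (norm_baseChange_le K _).trans (norm_map_X_le Φ i)
  refine ⟨aeval _ hΦ1 F, funext fun g => ?_, norm_aeval_le _ hΦ1 F⟩
  have hcoord : ∀ i, evalInt K (b.coord g) (baseChange K (Φ (X i))) =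
      algebraMap ℚ_[p] K (b'.coord g i) := fun i => by
    rw [evalInt_baseChange]
    have h1 := hΦ (evalInt ℚ_[p] (b.coord g))
    have h2 : b.ofPoint (evalInt ℚ_[p] (b.coord g)) = g := by
      rw [ofPoint, pointCoord_evalInt, orderedProd_coord]
    rw [h2] at h1
    have h3 := b'.coord_ofPoint ((evalInt ℚ_[p] (b.coord g)).comp Φ)
    rw [h1] at h3
    rw [h3]
    rfl
  rw [toFunction_apply, toFunction_apply,
    map_aeval _ hΦ1 (evalInt K (b.coord g)) (continuous_evalInt _) fun i => by
      rw [hcoord]; exact norm_padicInt_le_one _ i]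
  simp only [hcoord]
  rfl

end Functions

end OrderedBasis

end

theorem mainTheorem6 {p : ℕ} [Fact p.Prime] {H : Type*} [Group H] [TopologicalSpace H]
    [IsTopologicalGroup H] (ω : PValuation p H) (hω : ω.DefinesTopology) (hsat : ω.IsSaturated)
    {d : ℕ} (b b' : OrderedBasis ω d)
    (K : Type*) [NormedField K] [IsUltrametricDist K] [CompleteSpace K] [NormedAlgebra ℚ_[p] K]
    [FiniteDimensional ℚ_[p] K] :
    -- each basis has exactly one associated rigid analytic group
    ((∃! G, b.IsAssociated G) ∧ (∃! G', b'.IsAssociated G')) ∧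
    -- a unique isomorphism of rigid analytic groups compatible with the identifications with `H`
    (∀ G G', b.IsAssociated G → b'.IsAssociated G' →
      ∃! Θ : TateAlgebra ℚ_[p] (Fin d) ≃ₐ[ℚ_[p]] TateAlgebra ℚ_[p] (Fin d),
        G.IsGroupIso G' Θ ∧ ∀ φ, b'.ofPoint (φ.comp Θ.toAlgHom) = b.ofPoint φ) ∧
    -- rigid functions are continuous, with one expansion, so they form a copy of `K⟨Z⟩`
    (∀ F, Continuous (b.toFunction K F)) ∧
    Function.Injective (b.toFunction K) ∧
    (∀ F, b.gaussNorm K (b.toFunction K F) = ‖F‖) ∧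
    -- independence of the basis
    b.rigidFunctions K = b'.rigidFunctions K ∧
    ∀ f ∈ b.rigidFunctions K, b.gaussNorm K f = b'.gaussNorm K f := by
  have hle : ∀ b b' : OrderedBasis ω d, b'.rigidFunctions K ≤ b.rigidFunctions K := by
    rintro b b' _ ⟨F, rfl⟩
    obtain ⟨F', h, -⟩ := b.exists_toFunction_eq K hω hsat b' F
    exact ⟨F', h⟩
  have hex : ∀ b : OrderedBasis ω d, ∃! G, b.IsAssociated G := fun b => by
    obtain ⟨G, hG⟩ := b.exists_isAssociated hω hsat
    exact ⟨G, hG, fun G' hG' => OrderedBasis.IsAssociated.unique b hG' hG⟩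
  refine ⟨⟨hex b, hex b'⟩, fun G G' hG hG' => b.existsUnique_groupIso hω hsat b' hG hG',
    b.continuous_toFunction K, b.toFunction_injective K, b.gaussNorm_toFunction K,
    le_antisymm (hle b' b) (hle b b'), ?_⟩
  rintro _ ⟨F, rfl⟩
  obtain ⟨F', h1, h2⟩ := b'.exists_toFunction_eq K hω hsat b F
  obtain ⟨F'', h3, h4⟩ := b.exists_toFunction_eq K hω hsat b' F'
  rw [h1] at h3
  have h5 : F'' = F := b.toFunction_injective K h3
  rw [h5] at h4
  exact (b.gaussNorm_toFunction K F).trans ((le_antisymm h4 h2).trans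
    ((b'.gaussNorm_toFunction K F').symm.trans (congrArg _ h1)))
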